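/- Let $k$ be a field and let $p,q\in k^*$. Let $A=\mathscr{O}_{p,q}(\mathrm{SL}_2(k))$ be the $k$-algebra presented by generators $a,b,c,d$ subject to the relations $$ba=qab,\quad ca=pac,\quad db=qbd,\quad dc=pcd,\quad bc=cb,\quad ad-p^{-1}bc=1=da-qbc.$$ There is an algebra automorphism $\mu$ of $A$ with $$\mu(a)=(pq)^{-1}a,\qquad \mu(b)=b,\qquad \mu(c)=c,\qquad \mu(d)=(pq)d,$$ and $A$ is twisted Calabi–Yau of dimension $3$ with Nakayama automorphism $\mu$. Explicitly, with $A^e=A\otimes_k A^{\mathrm{op}}$, this means the following. (i) $A$ is smooth: as an $A$-bimodule (equivalently, as a left $A^e$-module), $A$ has a projective resolution of finite length by finitely generated projective modules. (ii) Let $H^i(A,{}_AA\otimes A_A)=\mathrm{Ext}^i_{A^e}(A,A^e)$, with the right $A^e$-module structure induced by right multiplication in the coefficient module $A^e$; a right $A^e$-module is regarded as an $A$-bimodule through $b\cdot x\cdot a=x\cdot(a\otimes b)$. Then, as $A$-bimodules, $$H^i(A,{}_AA\otimes A_A)\simeq\begin{cases}\{0\}&\text{if } i\neq 3,\\ A_\mu&\text{if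 } i=3,\end{cases}$$ where $A_\mu$ is the vector space $A$ with the bimodule structure $b\cdot x\cdot a=b\,x\,\mu(a)$. -/

import Mathlib

open CategoryTheory TensorProduct

universe u

/-! ### Bimodules, smoothness and Hochschild cohomology -/

namespace TwistedCY

section Bimodules

variable (k A : Type u) [Field k] [Ring A] [Algebra k A]

/-- The enveloping algebra `Aᵉ = A ⊗ Aᵒᵖ`. Left `Aᵉ`-modules are the same as `A`-bimodules
(on which `k` acts centrally), through `(a ⊗ op b) • x = a · x · b`. -/
abbrev Env : Type u := A ⊗[k] Aᵐᵒᵖ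

/-- The regular bimodule: `A` as a left `Aᵉ`-module, `(a ⊗ op b) • x = a * x * b`. -/
instance regularModule : Module (Env k A) A := instModuleTensorProductMop k A

theorem regular_smul (a b x : A) :
    (a ⊗ₜ[k] MulOpposite.op b : Env k A) • x = a * x * b :=
  AlgHom.mulLeftRight_apply k A a (MulOpposite.op b) x

/-- A left module `M` over a ring `R` is of type FP if it has a projective resolution
of finite length, all of whose terms are finitely generated (projective) modules. -/
def IsTypeFP (R : Type u) [Ring R] (M : Type u) [AddCommGroup M] [Module R M] : Prop :=
  ∃ P : ProjectiveResolution (ModuleCat.of R M),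
    (∀ i, Module.Finite R (P.complex.X i)) ∧
    ∃ n : ℕ, ∀ i, n < i → Limits.IsZero (P.complex.X i)

/-- An algebra is (homologically) smooth if it is of type FP as a bimodule over itself. -/
def IsSmooth : Prop := IsTypeFP (Env k A) A

/-- The Hochschild cohomology space `Hⁿ(A, A ⊗ A) = Extⁿ_{Aᵉ}(A, Aᵉ)`. The left `Aᵉ`-module
`Aᵉ` is the bimodule `A ⊗ A` with `a · (x ⊗ y) · b = a x ⊗ y b`. -/
abbrev HH (n : ℕ) : Type u :=
  Abelian.Ext (ModuleCat.of (Env k A) A) (ModuleCat.of (Env k A) (Env k A)) n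

/-- Right multiplication by `e`, as an endomorphism of the left `Aᵉ`-module `Aᵉ`. -/
def rightMul (e : Env k A) :
    ModuleCat.of (Env k A) (Env k A) ⟶ ModuleCat.of (Env k A) (Env k A) :=
  ModuleCat.ofHom (LinearMap.toSpanSingleton (Env k A) (Env k A) e)

theorem rightMul_apply (e x : Env k A) : (rightMul k A e).hom x = x * e := rfl

/-- The right `Aᵉ`-module structure (that is, left `(Aᵉ)ᵒᵖ`-module structure) on
`Extⁿ_{Aᵉ}(A, Aᵉ)` that is induced by right multiplication in the coefficients `Aᵉ`. -/
noncomputable instance hhModule (n : ℕ) : Module (Env k A)ᵐᵒᵖ (HH k A n) where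
  smul e α := α.comp (Abelian.Ext.mk₀ (rightMul k A e.unop)) (add_zero n)
  one_smul α := by
    change α.comp (Abelian.Ext.mk₀ (rightMul k A 1)) (add_zero n) = α
    have h : rightMul k A 1 = 𝟙 _ := by
      ext
      exact mul_one _
    rw [h, Abelian.Ext.comp_mk₀_id]
  mul_smul e f α := by
    change α.comp (Abelian.Ext.mk₀ (rightMul k A (f.unop * e.unop))) (add_zero n) =
      (α.comp (Abelian.Ext.mk₀ (rightMul k A f.unop)) (add_zero n)).comp
        (Abelian.Ext.mk₀ (rightMul k A e.unop)) (add_zero n)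
    have h : rightMul k A (f.unop * e.unop) = rightMul k A f.unop ≫ rightMul k A e.unop := by
      ext
      exact (mul_assoc _ _ _).symm
    rw [h, ← Abelian.Ext.mk₀_comp_mk₀, Abelian.Ext.comp_assoc_of_third_deg_zero]
  smul_zero e := Abelian.Ext.zero_comp _ _ (Abelian.Ext.mk₀ (rightMul k A e.unop)) _ (add_zero n)
  smul_add e α β := Abelian.Ext.add_comp _ _ _ _
  add_smul e f α := by
    change α.comp (Abelian.Ext.mk₀ (rightMul k A (e.unop + f.unop))) (add_zero n) =
      α.comp (Abelian.Ext.mk₀ (rightMul k A e.unop)) (add_zero n) +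
      α.comp (Abelian.Ext.mk₀ (rightMul k A f.unop)) (add_zero n)
    have h : rightMul k A (e.unop + f.unop) = rightMul k A e.unop + rightMul k A f.unop := by
      ext
      exact mul_add _ _ _
    rw [h, Abelian.Ext.mk₀_add, Abelian.Ext.comp_add]
  zero_smul α := by
    change α.comp (Abelian.Ext.mk₀ (rightMul k A 0)) (add_zero n) = 0
    have h : rightMul k A 0 = 0 := by
      ext
      exact mul_zero _
    rw [h, Abelian.Ext.mk₀_zero, Abelian.Ext.comp_zero]

variable {k A}

/-- The algebra isomorphism `(Aᵉ)ᵒᵖ ≅ Aᵉ`, `op (a ⊗ op b) ↦ b ⊗ op a`: it turns right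
`Aᵉ`-modules into bimodules, `b · x · a = x · (a ⊗ op b)`. -/
noncomputable def envFlip : (Env k A)ᵐᵒᵖ ≃ₐ[k] Env k A :=
  (Algebra.TensorProduct.opAlgEquiv k k A Aᵐᵒᵖ).symm.trans
    ((Algebra.TensorProduct.congr AlgEquiv.refl (AlgEquiv.opOp k A).symm).trans
      (Algebra.TensorProduct.comm k Aᵐᵒᵖ A))

theorem envFlip_op_tmul (a b : A) :
    envFlip (MulOpposite.op (a ⊗ₜ[k] MulOpposite.op b : Env k A)) = b ⊗ₜ MulOpposite.op a := by
  simp [envFlip, Algebra.TensorProduct.opAlgEquiv]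

/-- The space underlying the twisted bimodule `A_μ`. -/
def Twist (_μ : A ≃ₐ[k] A) : Type u := A

instance (μ : A ≃ₐ[k] A) : AddCommGroup (Twist μ) := inferInstanceAs (AddCommGroup A)

/-- The bimodule `A_μ`, in which `b · x · a = b * x * μ a`, as a right `Aᵉ`-module:
`x · (a ⊗ op b) = b * x * μ a`. -/
noncomputable instance twistModule (μ : A ≃ₐ[k] A) : Module (Env k A)ᵐᵒᵖ (Twist μ) :=
  Module.compHom A
    (((Algebra.TensorProduct.congr AlgEquiv.refl (AlgEquiv.op μ)).toAlgHom.comp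
      (envFlip (k := k) (A := A)).toAlgHom).toRingHom : (Env k A)ᵐᵒᵖ →+* Env k A)

theorem twist_smul (μ : A ≃ₐ[k] A) (a b x : A) :
    (MulOpposite.op (a ⊗ₜ[k] MulOpposite.op b : Env k A) • (show Twist μ from x) : Twist μ) =
      (b * x * μ a : A) := by
  change (Algebra.TensorProduct.congr AlgEquiv.refl (AlgEquiv.op μ)
    (envFlip (MulOpposite.op (a ⊗ₜ[k] MulOpposite.op b : Env k A))) : Env k A) • x = b * x * μ a
  rw [envFlip_op_tmul]
  exact regular_smul k A b (μ a) x

variable (k A)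

/-- `A` is twisted Calabi–Yau of dimension `n` with Nakayama automorphism `μ`: it is smooth,
`Hⁱ(A, A ⊗ A) = 0` for `i ≠ n`, and `Hⁿ(A, A ⊗ A) ≅ A_μ` as bimodules. -/
structure IsTwistedCalabiYau (n : ℕ) (μ : A ≃ₐ[k] A) : Prop where
  smooth : IsSmooth k A
  vanishing : ∀ i : ℕ, i ≠ n → Subsingleton (HH k A i)
  duality : Nonempty (HH k A n ≃ₗ[(Env k A)ᵐᵒᵖ] Twist μ)

end Bimodules

end TwistedCY

/-! ### The two-parameter quantum `SL₂` -/

namespace OSL2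

/-- The four generators. -/
inductive Gen : Type u
  | a | b | c | d

variable {k : Type u} [Field k]

/-- The generators in the free algebra. -/
def gen (x : Gen.{u}) : FreeAlgebra k Gen.{u} := FreeAlgebra.ι k x

/-- The defining relations. -/
inductive Rel (p q : k) : FreeAlgebra k Gen.{u} → FreeAlgebra k Gen.{u} → Prop
  | ba : Rel p q (gen .b * gen .a) (q • (gen .a * gen .b))
  | ca : Rel p q (gen .c * gen .a) (p • (gen .a * gen .c))
  | db : Rel p q (gen .d * gen .b) (q • (gen .b * gen .d))
  | dc : Rel p q (gen .d * gen .c) (p • (gen .c * gen .d))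
  | bc : Rel p q (gen .b * gen .c) (gen .c * gen .b)
  | ad : Rel p q (gen .a * gen .d - p⁻¹ • (gen .b * gen .c)) 1
  | da : Rel p q (gen .d * gen .a - q • (gen .b * gen .c)) 1

end OSL2

/-- The algebra `O_{p,q}(SL₂(k))`, presented by generators `a, b, c, d` and relations. -/
def OSL2 {k : Type u} [Field k] (p q : k) : Type u := RingQuot (OSL2.Rel p q)

namespace OSL2

variable {k : Type u} [Field k] (p q : k)

noncomputable instance : Ring (OSL2 p q) := inferInstanceAs (Ring (RingQuot (Rel p q)))

noncomputable instance : Algebra k (OSL2 p q) :=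
  inferInstanceAs (Algebra k (RingQuot (Rel p q)))

/-- The class of a generator. -/
noncomputable def of (x : Gen.{u}) : OSL2 p q := RingQuot.mkAlgHom k (Rel p q) (gen x)

/-- The generator `a`. -/
noncomputable def a : OSL2 p q := of p q .a

/-- The generator `b`. -/
noncomputable def b : OSL2 p q := of p q .b

/-- The generator `c`. -/
noncomputable def c : OSL2 p q := of p q .c

/-- The generator `d`. -/
noncomputable def d : OSL2 p q := of p q .d

end OSL2

/-! Write `E` for the enveloping algebra, and put `u = [[a, b], [c, d]]` and `v = [[d, -q b], [-p⁻¹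
c, a]]`. The relations of `A` say precisely that `u v = 1 = v u`. The proof builds a free resolution
`0 → E → E⁴ → E⁴ → E → A → 0`. Here `d₁` lists the commutators `x ⊗ 1 - 1 ⊗ x` of the generators,
the rows of `d₂` are the entries of the differentiated identity `du + u (dv) u = 0`, and `d₃` is a
twisted mirror image of `d₁`.

Exactness at the right end is formal. The kernel of multiplication is generated by commutators
(`exists_of_mulMap`), and the relations among these generators come from the derivatives of the
defining relations, because a derivation can be prescribed on generators as soon as it respects the
relations (`exists_of_sum_d₁`).

Next comes a normal form theorem (`pbwEquiv`): `A` is free over `k[b, c]`, so `E` is free over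
polynomials in two pairs of variables, and `b ⊗ 1 - 1 ⊗ b`, `c ⊗ 1 - 1 ⊗ c` behave as a regular
sequence on it. This shows that the dual complex is exact in degrees 0 and 1 (`eq_zero_of_d₁_mul`,
`exists_of_d₂_mul`).

Finally, the anti-automorphism `x ⊗ y ↦ y ⊗ μ x` of `E` identifies the complex with its dual, up to
nonzero scalars and reversal of the order of the bases (`flip_d₃`, `flip_d₂`). It carries exactness
of the dual complex in degrees 0 and 1 to exactness of the complex in degrees 3 and 2. In the other
direction it carries exactness in degree 1 to vanishing of `H²`, and the presentation of `A` in
degree 0 to `H³ ≅ A_μ`. -/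

set_option linter.unusedSimpArgs false

/-! ### Relations, universal property, scaling automorphisms and the isomorphism with the opposite
algebra. -/

namespace OSL2

open MulOpposite TwistedCY

section Relations

variable {k : Type u} [Field k] (p q : k)

/-- The quotient map from the free algebra. -/
noncomputable def proj : FreeAlgebra k Gen.{u} →ₐ[k] OSL2 p q := RingQuot.mkAlgHom k (Rel p q)

theorem proj_gen (x : Gen.{u}) : proj p q (gen x) = of p q x := rfl

theorem proj_rel {s t : FreeAlgebra k Gen.{u}} (h : Rel p q s t) : proj p q s = proj p q t :=
  RingQuot.mkAlgHom_rel k h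

theorem b_mul_a : b p q * a p q = q • (a p q * b p q) := by
  simpa [a, b, c, d, proj_gen] using proj_rel p q Rel.ba

theorem c_mul_a : c p q * a p q = p • (a p q * c p q) := by
  simpa [a, b, c, d, proj_gen] using proj_rel p q Rel.ca

theorem d_mul_b : d p q * b p q = q • (b p q * d p q) := by
  simpa [a, b, c, d, proj_gen] using proj_rel p q Rel.db

theorem d_mul_c : d p q * c p q = p • (c p q * d p q) := by
  simpa [a, b, c, d, proj_gen] using proj_rel p q Rel.dc

theorem c_mul_b : c p q * b p q = b p q * c p q := by
  simpa [a, b, c, d, proj_gen] using (proj_rel p q Rel.bc).symm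

theorem a_mul_d : a p q * d p q = 1 + p⁻¹ • (b p q * c p q) := by
  rw [← sub_eq_iff_eq_add]
  simpa [a, b, c, d, proj_gen] using proj_rel p q Rel.ad

theorem d_mul_a : d p q * a p q = 1 + q • (b p q * c p q) := by
  rw [← sub_eq_iff_eq_add]
  simpa [a, b, c, d, proj_gen] using proj_rel p q Rel.da

variable {p q}

theorem a_mul_b (hq : q ≠ 0) : a p q * b p q = q⁻¹ • (b p q * a p q) := by
  rw [b_mul_a, smul_smul, inv_mul_cancel₀ hq, one_smul]

theorem a_mul_c (hp : p ≠ 0) : a p q * c p q = p⁻¹ • (c p q * a p q) := by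
  rw [c_mul_a, smul_smul, inv_mul_cancel₀ hp, one_smul]

/-- Elements of a `k`-algebra that satisfy the defining relations. -/
structure IsQuad (p q : k) {B : Type*} [Ring B] [Algebra k B] (x y z w : B) : Prop where
  ba : y * x = q • (x * y)
  ca : z * x = p • (x * z)
  db : w * y = q • (y * w)
  dc : w * z = p • (z * w)
  bc : y * z = z * y
  ad : x * w - p⁻¹ • (y * z) = 1
  da : w * x - q • (y * z) = 1

/-- The family of four elements, indexed by the generators. -/
def Gen.pick {B : Type*} (x y z w : B) : Gen.{u} → B
  | .a => x
  | .b => y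
  | .c => z
  | .d => w

section Lift

variable {B : Type*} [Ring B] [Algebra k B] {x y z w : B}

/-- The universal property of the presented algebra. -/
noncomputable def lift (h : IsQuad p q x y z w) : OSL2 p q →ₐ[k] B :=
  RingQuot.liftAlgHom k ⟨FreeAlgebra.lift k (Gen.pick x y z w), by
    intro s t hst
    cases hst <;> simp only [gen, map_mul, map_smul, map_sub, map_one, FreeAlgebra.lift_ι_apply,
      Gen.pick]
    exacts [h.ba, h.ca, h.db, h.dc, h.bc, h.ad, h.da]⟩

variable (h : IsQuad p q x y z w)

theorem lift_of (g : Gen.{u}) : lift h (of p q g) = Gen.pick x y z w g := by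
  refine (RingQuot.liftAlgHom_mkAlgHom_apply k _ _ _).trans ?_
  simp [gen]

@[simp] theorem lift_a : lift h (a p q) = x := lift_of h .a
@[simp] theorem lift_b : lift h (b p q) = y := lift_of h .b
@[simp] theorem lift_c : lift h (c p q) = z := lift_of h .c
@[simp] theorem lift_d : lift h (d p q) = w := lift_of h .d

theorem algHom_ext {f g : OSL2 p q →ₐ[k] B} (ha : f (a p q) = g (a p q))
    (hb : f (b p q) = g (b p q)) (hc : f (c p q) = g (c p q)) (hd : f (d p q) = g (d p q)) :
    f = g := by
  apply RingQuot.ringQuot_ext' k (s := Rel p q)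
  apply FreeAlgebra.hom_ext
  funext i
  cases i
  exacts [ha, hb, hc, hd]

end Lift

/-- Induction on the construction of an element from the generators. -/
theorem induction_gen {P : OSL2 p q → Prop} (h0 : ∀ r : k, P (algebraMap k _ r))
    (ha : P (a p q)) (hb : P (b p q)) (hc : P (c p q)) (hd : P (d p q))
    (hadd : ∀ x y, P x → P y → P (x + y)) (hmul : ∀ x y, P x → P y → P (x * y))
    (x : OSL2 p q) : P x := by
  obtain ⟨x, rfl⟩ := RingQuot.mkAlgHom_surjective k (Rel p q) x
  induction x using FreeAlgebra.induction with
  | grade0 r => rw [AlgHom.commutes]; exact h0 r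
  | grade1 i => cases i; exacts [ha, hb, hc, hd]
  | mul x y hx hy => rw [map_mul]; exact hmul _ _ hx hy
  | add x y hx hy => rw [map_add]; exact hadd _ _ hx hy

/-- The relations are stable under rescaling `a` and `d` by inverse scalars. -/
theorem isQuad_scale (r s : k) (hrs : r * s = 1) :
    IsQuad p q (r • a p q) (b p q) (c p q) (s • d p q) where
  ba := by simp [b_mul_a, smul_smul, mul_comm]
  ca := by simp [c_mul_a, smul_smul, mul_comm]
  db := by simp [d_mul_b, smul_smul, mul_comm]
  dc := by simp [d_mul_c, smul_smul, mul_comm]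
  bc := (c_mul_b p q).symm
  ad := by rw [smul_mul_smul_comm, hrs, one_smul, a_mul_d]; abel
  da := by rw [smul_mul_smul_comm, mul_comm s, hrs, one_smul, d_mul_a]; abel

/-- The automorphism that multiplies `a` by `r` and `d` by `s = r⁻¹`. -/
noncomputable def scale (r s : k) (hrs : r * s = 1) : OSL2 p q ≃ₐ[k] OSL2 p q :=
  AlgEquiv.ofAlgHom (lift (isQuad_scale r s hrs)) (lift (isQuad_scale s r (by rwa [mul_comm])))
    (algHom_ext (by simp [smul_smul, hrs, mul_comm s]) (by simp) (by simp)
      (by simp [smul_smul, hrs]))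
    (algHom_ext (by simp [smul_smul, hrs]) (by simp) (by simp)
      (by simp [smul_smul, hrs, mul_comm s]))

section Scale
variable (r s : k) (hrs : r * s = 1)
@[simp] theorem scale_a : scale r s hrs (a p q) = r • a p q := lift_a (isQuad_scale r s hrs)
@[simp] theorem scale_b : scale r s hrs (b p q) = b p q := lift_b (isQuad_scale r s hrs)
@[simp] theorem scale_c : scale r s hrs (c p q) = c p q := lift_c (isQuad_scale r s hrs)
@[simp] theorem scale_d : scale r s hrs (d p q) = s • d p q := lift_d (isQuad_scale r s hrs)
end Scale

/-- The opposite algebra satisfies the same relations with `a` and `d` exchanged. -/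
theorem isQuad_op : IsQuad p q (op (d p q)) (op (b p q)) (op (c p q)) (op (a p q)) where
  ba := by simp only [← op_mul, ← op_smul, d_mul_b]
  ca := by simp only [← op_mul, ← op_smul, d_mul_c]
  db := by simp only [← op_mul, ← op_smul, b_mul_a]
  dc := by simp only [← op_mul, ← op_smul, c_mul_a]
  bc := by simp only [← op_mul, c_mul_b]
  ad := by simp only [← op_mul, ← op_smul, c_mul_b, a_mul_d, ← op_one]; simp
  da := by simp only [← op_mul, ← op_smul, c_mul_b, d_mul_a, ← op_one]; simp

theorem unop_lift_isQuad_op (x : OSL2 p q) :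
    (lift isQuad_op (lift isQuad_op x : (OSL2 p q)ᵐᵒᵖ).unop : (OSL2 p q)ᵐᵒᵖ).unop = x :=
  have h : (AlgHom.opComm (lift (isQuad_op (p := p) (q := q)))).comp (lift isQuad_op) =
      AlgHom.id k (OSL2 p q) := algHom_ext (by simp) (by simp) (by simp) (by simp)
  DFunLike.congr_fun h x

/-- The isomorphism with the opposite algebra that exchanges `a` and `d`. -/
noncomputable def opEquiv (p q : k) : OSL2 p q ≃ₐ[k] (OSL2 p q)ᵐᵒᵖ where
  __ := lift isQuad_op
  invFun y := (lift isQuad_op y.unop : (OSL2 p q)ᵐᵒᵖ).unop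
  left_inv := unop_lift_isQuad_op
  right_inv y := unop_injective (unop_lift_isQuad_op y.unop)

theorem opEquiv_b : opEquiv p q (b p q) = op (b p q) := lift_b (isQuad_op (p := p) (q := q))
theorem opEquiv_c : opEquiv p q (c p q) = op (c p q) := lift_c (isQuad_op (p := p) (q := q))

end Relations

end OSL2

/-! ### Normal forms: the algebra is free over `k[b, c]`. -/

namespace OSL2

open MulOpposite TwistedCY

section PBW

variable {k : Type u} [Field k] (p q : k)

/-- The polynomial ring in the two commuting variables `b` and `c`. -/
abbrev BC (k : Type u) [Field k] : Type u := MvPolynomial (Fin 2) k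

/-- Rescaling the two variables. -/
noncomputable def rescale (s r : k) : BC k →ₐ[k] BC k :=
  MvPolynomial.aeval ![s • MvPolynomial.X 0, r • MvPolynomial.X 1]

@[simp] theorem rescale_X_zero (s r : k) :
    rescale s r (MvPolynomial.X 0) = s • MvPolynomial.X 0 := by simp [rescale]

@[simp] theorem rescale_X_one (s r : k) :
    rescale s r (MvPolynomial.X 1) = r • MvPolynomial.X 1 := by simp [rescale]

theorem rescale_rescale {s r s' r' : k} (hs : s * s' = 1) (hr : r * r' = 1) (f : BC k) :
    rescale s r (rescale s' r' f) = f := by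
  have h : (rescale s r).comp (rescale s' r') = AlgHom.id k (BC k) := by
    apply MvPolynomial.algHom_ext
    intro i
    fin_cases i <;> simp [smul_smul, mul_comm, hs, hr]
  exact DFunLike.congr_fun h f

/-- The space of the left regular representation, in the basis `b ^ i c ^ j a ^ n`,
`b ^ i c ^ j d ^ n`. -/
abbrev PBW (k : Type u) [Field k] : Type u := ℤ →₀ BC k

/-- The product `b c` in the polynomial ring. -/
noncomputable abbrev bc : BC k := MvPolynomial.X 0 * MvPolynomial.X 1

/-- The structure coefficients of left multiplication by `a`. -/
noncomputable def coeffA (n : ℤ) : BC k := if 0 ≤ n then 1 else 1 + p⁻¹ • bc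

/-- The structure coefficients of left multiplication by `d`. -/
noncomputable def coeffD (n : ℤ) : BC k := if 1 ≤ n then 1 + q • bc else 1

/-- A weighted shift operator. -/
noncomputable def shiftOp (σ : BC k →ₐ[k] BC k) (m : ℤ) (w : ℤ → BC k) : Module.End k (PBW k) :=
  Finsupp.lsum k fun n => Finsupp.lsingle (n + m) ∘ₗ LinearMap.mulLeft k (w n) ∘ₗ σ.toLinearMap

@[simp] theorem shiftOp_single (σ : BC k →ₐ[k] BC k) (m : ℤ) (w : ℤ → BC k) (n : ℤ) (f : BC k) :
    shiftOp σ m w (Finsupp.single n f) = Finsupp.single (n + m) (w n * σ f) := by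
  simp [shiftOp]

/-- Multiplication by a polynomial. -/
noncomputable def polyOp (f : BC k) : Module.End k (PBW k) := Algebra.lsmul k k (PBW k) f

@[simp] theorem polyOp_apply (f : BC k) (x : PBW k) : polyOp f x = f • x := rfl

variable {p q}

theorem end_ext {f g : Module.End k (PBW k)}
    (h : ∀ n x, f (Finsupp.single n x) = g (Finsupp.single n x)) : f = g :=
  Finsupp.lhom_ext h

/-- The weights differ from 1 only on opposite sides of the passage between powers of `d` and powers
of `a`. In a composite of the two shifts exactly one weight is therefore nontrivial, whatever `n`
is. -/
theorem coeffA_mul (hq : q ≠ 0) (n : ℤ) :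
    coeffA p (n + -1) * rescale q⁻¹ p⁻¹ (coeffD q n) = 1 + p⁻¹ • bc := by
  unfold coeffA coeffD
  split_ifs with h1 h2 h2
  · simp [smul_smul, mul_left_comm q, hq]
  · omega
  · omega
  · simp

theorem coeffD_mul (hp : p ≠ 0) (n : ℤ) :
    coeffD q (n + 1) * rescale q p (coeffA p n) = 1 + q • bc := by
  unfold coeffA coeffD
  split_ifs with h1 h2 h2
  · simp
  · omega
  · omega
  · simp [smul_smul, hp, mul_comm]

/-- The operators imitate left multiplication on expressions `f(b, c) a ^ n` and `f(b, c) d ^ n`: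
moving `a` or `d` past `f` rescales the variables, and the weight accounts for a possible
cancellation `a d` or `d a`. Realizing the relations on a free module is what prevents normal forms
from collapsing. -/
theorem isQuad_regular (hp : p ≠ 0) (hq : q ≠ 0) :
    IsQuad p q (shiftOp (rescale q⁻¹ p⁻¹) 1 (coeffA p)) (polyOp (MvPolynomial.X 0))
      (polyOp (MvPolynomial.X 1)) (shiftOp (rescale q p) (-1) (coeffD q)) where
  ba := end_ext fun n x => by
    simp [-Finsupp.single_mul, smul_smul, hq, mul_left_comm]
  ca := end_ext fun n x => by
    simp [-Finsupp.single_mul, smul_smul, hp, mul_left_comm]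
  db := end_ext fun n x => by
    simp [-Finsupp.single_mul, mul_left_comm]
  dc := end_ext fun n x => by
    simp [-Finsupp.single_mul, mul_left_comm]
  bc := end_ext fun n x => by
    simp [-Finsupp.single_mul, mul_left_comm]
  ad := end_ext fun n x => by
    have h := coeffA_mul (p := p) hq n
    have h' := rescale_rescale (inv_mul_cancel₀ hq) (inv_mul_cancel₀ hp) x
    simp [-Finsupp.single_mul, h', ← mul_assoc, h, add_mul]
  da := end_ext fun n x => by
    have h := coeffD_mul (q := q) hp n
    have h' := rescale_rescale (mul_inv_cancel₀ hq) (mul_inv_cancel₀ hp) x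
    simp [-Finsupp.single_mul, h', ← mul_assoc, h, add_mul]

variable (p q) in
/-- The subalgebra generated by `b` and `c`. -/
noncomputable abbrev bcAdjoin : Subalgebra k (OSL2 p q) := Algebra.adjoin k {b p q, c p q}

/-- Polynomials can only be evaluated in a commutative algebra, hence the detour through this
subalgebra in `polyMap`. -/
instance : IsMulCommutative (bcAdjoin p q) :=
  Algebra.isMulCommutative_adjoin k (by
    intro x hx y hy
    rcases hx with rfl | rfl <;> rcases hy with rfl | rfl <;> simp [c_mul_b])

variable (p q) in
open scoped IsMulCommutative in
/-- The inclusion of the polynomials in `b` and `c`. -/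
noncomputable def polyMap : BC k →ₐ[k] OSL2 p q :=
  (bcAdjoin p q).val.comp (MvPolynomial.aeval
    ![(⟨b p q, Algebra.subset_adjoin (by simp)⟩ : bcAdjoin p q),
      ⟨c p q, Algebra.subset_adjoin (by simp)⟩])

@[simp] theorem polyMap_X_zero : polyMap p q (MvPolynomial.X 0) = b p q := by simp [polyMap]

@[simp] theorem polyMap_X_one : polyMap p q (MvPolynomial.X 1) = c p q := by simp [polyMap]

theorem mul_polyMap {x : OSL2 p q} {s r : k} (hb : x * b p q = s • (b p q * x))
    (hc : x * c p q = r • (c p q * x)) (f : BC k) :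
    x * polyMap p q f = polyMap p q (rescale s r f) * x := by
  induction f using MvPolynomial.induction_on with
  | C r => simpa [← MvPolynomial.algebraMap_eq] using (Algebra.commutes r x).symm
  | add f g hf hg => simp only [map_add, mul_add, add_mul, hf, hg]
  | mul_X f i hf =>
    rw [map_mul, ← mul_assoc, hf, mul_assoc, map_mul, map_mul, mul_assoc]
    fin_cases i <;> simp [hb, hc]

variable (p q) in
/-- The words `a ^ n`, `d ^ n`. -/
noncomputable def word (n : ℤ) : OSL2 p q := if 0 ≤ n then a p q ^ n.toNat else d p q ^ (-n).toNat

theorem a_mul_word (n : ℤ) : a p q * word p q n = polyMap p q (coeffA p n) * word p q (n + 1) := by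
  rcases n with m | m
  · have h1 : (Int.ofNat m + 1).toNat = m + 1 := by simp
    have h2 : (0 : ℤ) ≤ Int.ofNat m + 1 := by simp; omega
    have h3 : (0 : ℤ) ≤ Int.ofNat m := Int.natCast_nonneg m
    rw [word, word, coeffA, h1, if_pos h2, if_pos h3, if_pos h3, map_one, one_mul, pow_succ']
    rfl
  · have h1 : ¬ (0 ≤ Int.negSucc m) := by simp
    have h2 : (-Int.negSucc m).toNat = m + 1 := rfl
    have h3 : word p q (Int.negSucc m + 1) = d p q ^ m := by
      unfold word
      cases m with
      | zero => simp
      | succ m =>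
        have : (-(Int.negSucc (m + 1) + 1)).toNat = m + 1 := by omega
        rw [if_neg (by omega), this]
    rw [h3]
    simp [word, coeffA, h1, h2, pow_succ', ← mul_assoc, a_mul_d]

theorem d_mul_word (n : ℤ) : d p q * word p q n = polyMap p q (coeffD q n) * word p q (n + -1) := by
  rcases le_or_gt 1 n with h | h
  · obtain ⟨m, rfl⟩ : ∃ m : ℕ, n = m + 1 := ⟨(n - 1).toNat, by omega⟩
    have h1 : word p q (m + 1) = a p q ^ (m + 1) := if_pos (by omega)
    have h2 : word p q ((m + 1 : ℤ) + -1) = a p q ^ m := by simp [word]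
    rw [h1, h2, pow_succ', ← mul_assoc, d_mul_a]
    simp [coeffD]
  · obtain ⟨m, rfl⟩ : ∃ m : ℕ, n = -m := ⟨(-n).toNat, by omega⟩
    have h1 : word p q (-m) = d p q ^ m := by cases m <;> simp [word]; omega
    have h2 : word p q (-m + -1) = d p q ^ (m + 1) := by
      have : (-(-m + -1 : ℤ)).toNat = m + 1 := by omega
      rw [word, if_neg (by omega), this]
    rw [h1, h2, coeffD, if_neg (by omega), map_one, one_mul, pow_succ']

variable (p q) in
/-- The evaluation of a normal form in the algebra. -/
noncomputable def ofPBW : PBW k →ₗ[k] OSL2 p q :=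
  Finsupp.lsum k fun n => LinearMap.mulRight k (word p q n) ∘ₗ (polyMap p q).toLinearMap

@[simp] theorem ofPBW_single (n : ℤ) (f : BC k) :
    ofPBW p q (Finsupp.single n f) = polyMap p q f * word p q n := by
  simp [ofPBW]

/-- The left regular representation on normal forms. -/
noncomputable def regular (hp : p ≠ 0) (hq : q ≠ 0) : OSL2 p q →ₐ[k] Module.End k (PBW k) :=
  lift (isQuad_regular hp hq)

section
variable (hp : p ≠ 0) (hq : q ≠ 0)

/-- Evaluated at the normal form of 1, this shows that normal forms span: `ofPBW` is a left inverse
of the orbit map of that vector. Only the four generators need a computation. -/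
theorem ofPBW_regular (x : OSL2 p q) (v : PBW k) :
    ofPBW p q (regular hp hq x v) = x * ofPBW p q v := by
  have key (x : OSL2 p q) (h : ∀ n f, ofPBW p q (regular hp hq x (Finsupp.single n f)) =
      x * ofPBW p q (Finsupp.single n f)) (v : PBW k) :
      ofPBW p q (regular hp hq x v) = x * ofPBW p q v := by
    have : ofPBW p q ∘ₗ regular hp hq x = LinearMap.mulLeft k x ∘ₗ ofPBW p q :=
      Finsupp.lhom_ext h
    exact LinearMap.congr_fun this v
  induction x using induction_gen generalizing v with
  | h0 r => simp [Algebra.algebraMap_eq_smul_one]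
  | ha =>
    refine key _ (fun n f => ?_) v
    simp only [regular, lift_a, shiftOp_single, ofPBW_single, map_mul]
    rw [← mul_assoc, mul_polyMap (a_mul_b hq) (a_mul_c hp), mul_assoc _ (a p q), a_mul_word,
      ← mul_assoc, ← map_mul, ← map_mul, mul_comm]
  | hb =>
    refine key _ (fun n f => ?_) v
    simp [-Finsupp.single_mul, regular, mul_assoc]
  | hc =>
    refine key _ (fun n f => ?_) v
    simp [-Finsupp.single_mul, regular, mul_assoc]
  | hd =>
    refine key _ (fun n f => ?_) v
    simp only [regular, lift_d, shiftOp_single, ofPBW_single, map_mul]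
    rw [← mul_assoc, mul_polyMap (d_mul_b p q) (d_mul_c p q), mul_assoc _ (d p q), d_mul_word,
      ← mul_assoc, ← map_mul, ← map_mul, mul_comm]
  | hadd x y hx hy => simp [hx, hy, add_mul]
  | hmul x y hx hy => simp [hx, hy, mul_assoc]

theorem regular_polyMap (f : BC k) : regular hp hq (polyMap p q f) = polyOp f := by
  induction f using MvPolynomial.induction_on with
  | C r =>
    refine LinearMap.ext fun x => ?_
    simp [← MvPolynomial.algebraMap_eq, Algebra.algebraMap_eq_smul_one]
  | add f g hf hg => simp [hf, hg, polyOp]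
  | mul_X f i hf =>
    rw [map_mul, map_mul, hf]
    fin_cases i <;> simp [polyOp, regular]

/-- Together with `regular_polyMap` this gives the independence of normal forms: the orbit map
recovers the coefficients of `ofPBW v`. -/
theorem regular_word (n : ℤ) :
    regular hp hq (word p q n) (Finsupp.single 0 1) = Finsupp.single n 1 := by
  unfold word
  split_ifs with h
  · obtain ⟨m, rfl⟩ := Int.eq_ofNat_of_zero_le h
    simp only [Int.toNat_natCast, map_pow]
    clear h
    induction m with
    | zero => simp
    | succ m ih => rw [pow_succ', Module.End.mul_apply, ih]; simp [regular, coeffA]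
  · obtain ⟨m, rfl⟩ : ∃ m : ℕ, n = -m := ⟨(-n).toNat, by omega⟩
    simp only [neg_neg, Int.toNat_natCast, map_pow]
    clear h
    induction m with
    | zero => simp
    | succ m ih =>
      have : ¬ (1 ≤ -(m : ℤ)) := by omega
      rw [pow_succ', Module.End.mul_apply, ih]
      simp [regular, coeffD, this, add_comm]

/-- The normal form isomorphism: the algebra is free as a left module over `k[b, c]`. -/
noncomputable def pbwEquiv : OSL2 p q ≃ₗ[k] PBW k where
  __ := (LinearMap.applyₗ (Finsupp.single 0 1 : PBW k)) ∘ₗ (regular hp hq).toLinearMap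
  invFun := ofPBW p q
  left_inv x := by
    simp [ofPBW_regular, word]
  right_inv v := by
    have h : ((LinearMap.applyₗ (Finsupp.single 0 1 : PBW k)) ∘ₗ
        (regular hp hq).toLinearMap) ∘ₗ ofPBW p q = LinearMap.id := by
      refine Finsupp.lhom_ext fun n f => ?_
      simp [regular_word, regular_polyMap]
    exact LinearMap.congr_fun h v

theorem pbwEquiv_b_mul (x : OSL2 p q) :
    pbwEquiv hp hq (b p q * x) = (MvPolynomial.X 0 : BC k) • pbwEquiv hp hq x := by
  simp [pbwEquiv, regular]

theorem pbwEquiv_c_mul (x : OSL2 p q) :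
    pbwEquiv hp hq (c p q * x) = (MvPolynomial.X 1 : BC k) • pbwEquiv hp hq x := by
  simp [pbwEquiv, regular]

end

end PBW

end OSL2

/-! ### Pure tensors in the enveloping algebra. -/

namespace TwistedCY

open MulOpposite

section PureTensors

variable {k A : Type u} [Field k] [Ring A] [Algebra k A]

/-- The element `x ⊗ op y` of the enveloping algebra, as a bilinear map. -/
noncomputable def bi : A →ₗ[k] A →ₗ[k] Env k A :=
  (TensorProduct.mk k A Aᵐᵒᵖ).compl₂ (opLinearEquiv k : A ≃ₗ[k] Aᵐᵒᵖ).toLinearMap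

theorem bi_apply (x y : A) : (bi x y : Env k A) = x ⊗ₜ[k] op y := rfl

theorem bi_mul_bi (x y x' y' : A) :
    (bi x y * bi x' y' : Env k A) = bi (x * x') (y' * y) := by
  simp [bi_apply]

theorem one_eq_bi : (1 : Env k A) = bi 1 1 := rfl

theorem env_induction {P : Env k A → Prop} (h0 : P 0) (hb : ∀ x y : A, P (bi x y))
    (hadd : ∀ z w, P z → P w → P (z + w)) (z : Env k A) : P z := by
  induction z using TensorProduct.induction_on with
  | zero => exact h0
  | tmul x y => exact hb x y.unop
  | add z w hz hw => exact hadd z w hz hw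

end PureTensors

end TwistedCY

/-! ### Freeness of the enveloping algebra and a regular sequence. -/

namespace OSL2

open MulOpposite TwistedCY MvPolynomial

section Regularity

variable {k : Type u} [Field k] {p q : k}

/-- Polynomials in two pairs of variables. -/
abbrev BCBC (k : Type u) [Field k] : Type u := MvPolynomial (Fin 2 ⊕ Fin 2) k

/-- Extracting coefficients from a tensor product of normal forms. -/
noncomputable def pbwTensor : PBW k ⊗[k] PBW k ≃ₗ[k] (ℤ × ℤ →₀ BCBC k) :=
  finsuppTensorFinsupp k k (BC k) (BC k) ℤ ℤ ≪≫ₗ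
    Finsupp.mapRange.linearEquiv (tensorEquivSum k (Fin 2) (Fin 2) k).toLinearEquiv

theorem pbwTensor_smul_tmul (f g : BC k) (v w : PBW k) :
    pbwTensor ((f • v) ⊗ₜ (g • w)) =
      tensorEquivSum k (Fin 2) (Fin 2) k (f ⊗ₜ g) • pbwTensor (v ⊗ₜ w) := by
  induction v using Finsupp.induction_linear with
  | zero => simp
  | add v v' hv hv' => simp only [smul_add, add_tmul, map_add, hv, hv']
  | single m x =>
    induction w using Finsupp.induction_linear with
    | zero => simp
    | add v v' hv hv' => simp only [smul_add, tmul_add, map_add, hv, hv']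
    | single n y =>
      simp only [pbwTensor, Finsupp.smul_single, LinearEquiv.trans_apply, smul_eq_mul,
        finsuppTensorFinsupp_single, Finsupp.mapRange.linearEquiv_apply,
        Finsupp.mapRange.linearMap_apply, Finsupp.mapRange_single]
      rw [AlgEquiv.coe_toLinearEquiv, ← Algebra.TensorProduct.tmul_mul_tmul, map_mul]

/-- The enveloping algebra is free over the polynomials in two pairs of variables. -/
noncomputable def envEquiv (hp : p ≠ 0) (hq : q ≠ 0) :
    Env k (OSL2 p q) ≃ₗ[k] (ℤ × ℤ →₀ BCBC k) :=
  TensorProduct.congr (pbwEquiv hp hq)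
    ((opEquiv p q).symm.toLinearEquiv ≪≫ₗ pbwEquiv hp hq) ≪≫ₗ pbwTensor

section
variable (hp : p ≠ 0) (hq : q ≠ 0)

theorem envEquiv_left {x : OSL2 p q} {f : BC k}
    (h : ∀ y, pbwEquiv hp hq (x * y) = f • pbwEquiv hp hq y) (z : Env k (OSL2 p q)) :
    envEquiv hp hq (bi x 1 * z) =
      tensorEquivSum k (Fin 2) (Fin 2) k (f ⊗ₜ 1) • envEquiv hp hq z := by
  induction z using env_induction with
  | h0 => simp
  | hadd z w hz hw => rw [mul_add, map_add, hz, hw, map_add, smul_add]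
  | hb y y' =>
    simp only [bi_apply, envEquiv, Algebra.TensorProduct.tmul_mul_tmul, LinearEquiv.trans_apply,
      TensorProduct.congr_tmul, h, op_one, one_mul]
    rw [← pbwTensor_smul_tmul, one_smul]

/-- The opposite factor is read through `opEquiv`, which fixes `b` and `c`. Multiplication by these
elements in the opposite factor thus becomes left multiplication in `A`, where the normal form
applies. -/
theorem envEquiv_right {x : OSL2 p q} {f : BC k} (hx : opEquiv p q x = op x)
    (h : ∀ y, pbwEquiv hp hq (x * y) = f • pbwEquiv hp hq y) (z : Env k (OSL2 p q)) :
    envEquiv hp hq (bi 1 x * z) =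
      tensorEquivSum k (Fin 2) (Fin 2) k (1 ⊗ₜ f) • envEquiv hp hq z := by
  have hx' : (opEquiv p q).symm (op x) = x := by rw [← hx, AlgEquiv.symm_apply_apply]
  induction z using env_induction with
  | h0 => simp
  | hadd z w hz hw => rw [mul_add, map_add, hz, hw, map_add, smul_add]
  | hb y y' =>
    simp only [bi_apply, envEquiv, Algebra.TensorProduct.tmul_mul_tmul, LinearEquiv.trans_apply,
      TensorProduct.congr_tmul, h, one_mul, AlgEquiv.toLinearEquiv_apply, map_mul, hx']
    rw [← pbwTensor_smul_tmul, one_smul]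

theorem envEquiv_b_left (z : Env k (OSL2 p q)) :
    envEquiv hp hq (bi (b p q) 1 * z) = (X (.inl 0) : BCBC k) • envEquiv hp hq z := by
  rw [envEquiv_left hp hq (pbwEquiv_b_mul hp hq), tensorEquivSum_X_tmul_one]

theorem envEquiv_c_left (z : Env k (OSL2 p q)) :
    envEquiv hp hq (bi (c p q) 1 * z) = (X (.inl 1) : BCBC k) • envEquiv hp hq z := by
  rw [envEquiv_left hp hq (pbwEquiv_c_mul hp hq), tensorEquivSum_X_tmul_one]

theorem envEquiv_b_right (z : Env k (OSL2 p q)) :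
    envEquiv hp hq (bi 1 (b p q) * z) = (X (.inr 0) : BCBC k) • envEquiv hp hq z := by
  rw [envEquiv_right hp hq opEquiv_b (pbwEquiv_b_mul hp hq), tensorEquivSum_one_tmul_X]

theorem envEquiv_c_right (z : Env k (OSL2 p q)) :
    envEquiv hp hq (bi 1 (c p q) * z) = (X (.inr 1) : BCBC k) • envEquiv hp hq z := by
  rw [envEquiv_right hp hq opEquiv_c (pbwEquiv_c_mul hp hq), tensorEquivSum_one_tmul_X]

end

theorem X_sub_smul_X_ne_zero {ι : Type*} {i j : ι} (hij : i ≠ j) (s : k) :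
    (X i - s • X j : MvPolynomial ι k) ≠ 0 := by
  classical
  intro h
  have := congrArg (MvPolynomial.aeval fun l => if l = i then (1 : k) else 0) h
  simp [hij.symm] at this

/-- Divisibility by a difference of two variables is detected by identifying them. -/
theorem X_sub_X_dvd_of_mul {ι : Type*} {i j : ι} {f g : MvPolynomial ι k} {l m : ι}
    (hl : l ≠ i) (hm : m ≠ i) (hlm : l ≠ m) (h : (X i - X j) * f = (X l - X m) * g) :
    (X i - X j) ∣ g := by
  classical
  -- Substituting `X j` for `X i` is the identity modulo `X i - X j`, and it leaves the nonzero
  -- factor `X l - X m` unchanged. It therefore kills `g`.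
  let φ : MvPolynomial ι k →ₐ[k] MvPolynomial ι k :=
    MvPolynomial.aeval fun l => if l = i then X j else X l
  by_cases hij : j = i
  · subst hij
    rw [sub_self, zero_mul] at h
    have h1 : (X l - X m : MvPolynomial ι k) ≠ 0 := by
      simpa using X_sub_smul_X_ne_zero hlm (1 : k)
    rw [(mul_eq_zero.1 h.symm).resolve_left h1]
    exact dvd_zero _
  have hφ : (Ideal.Quotient.mkₐ k (Ideal.span {(X i - X j : MvPolynomial ι k)})).comp φ =
      Ideal.Quotient.mkₐ k (Ideal.span {(X i - X j : MvPolynomial ι k)}) := by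
    apply MvPolynomial.algHom_ext
    intro n
    by_cases hn : n = i
    · simp only [φ, AlgHom.comp_apply, aeval_X, hn, if_true, Ideal.Quotient.mkₐ_eq_mk]
      exact (Ideal.Quotient.mk_eq_mk_iff_sub_mem _ _).2
        (Ideal.mem_span_singleton.2 ⟨-1, by ring⟩)
    · simp [φ, hn]
  have h0 : φ g = 0 := by
    have := congrArg φ h
    simp only [map_mul, map_sub, φ, aeval_X, if_true, if_neg hij, hl, hm, if_false, sub_self,
      zero_mul] at this
    refine (mul_eq_zero.1 this.symm).resolve_left ?_
    simpa using X_sub_smul_X_ne_zero hlm (1 : k)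
  have h1 := DFunLike.congr_fun hφ g
  rw [AlgHom.comp_apply, h0, map_zero] at h1
  exact Ideal.mem_span_singleton.1 (Ideal.Quotient.eq_zero_iff_mem.1 h1.symm)

theorem finsupp_smul_eq_zero {ι S : Type*} [CommRing S] [IsDomain S] {s : S} (hs : s ≠ 0)
    {v : ι →₀ S} (h : s • v = 0) : v = 0 :=
  (smul_eq_zero.1 h).resolve_left hs

theorem exists_smul_of_dvd {ι S : Type*} [CommRing S] {s : S} {v : ι →₀ S}
    (h : ∀ i : ι, s ∣ v i) : ∃ w : ι →₀ S, v = s • w := by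
  classical
  choose f hf using h
  -- The chosen quotients are reset to 0 where `v` vanishes, so that the support stays finite.
  refine ⟨Finsupp.onFinset v.support (fun i => if v i = 0 then 0 else f i) ?_, ?_⟩
  · intro i hi
    simp only [ne_eq, ite_eq_left_iff, not_forall] at hi
    simpa using hi.1
  · ext i
    by_cases hi : v i = 0 <;> simp [hi]
    exact hf i

/-- Multiplication by this element is multiplication by a nonzero polynomial on a free module over a
domain. The values `s = 1`, `q` and `q⁻¹` all occur below. -/
theorem b_regular (hp : p ≠ 0) (hq : q ≠ 0) (s : k) {z : Env k (OSL2 p q)}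
    (h : (bi (b p q) 1 - s • bi 1 (b p q)) * z = 0) : z = 0 := by
  apply (envEquiv hp hq).injective
  rw [map_zero]
  refine finsupp_smul_eq_zero
    (X_sub_smul_X_ne_zero (i := Sum.inl 0) (j := Sum.inr 0) (by simp) s) ?_
  rw [sub_smul, smul_assoc, ← envEquiv_b_left, ← envEquiv_b_right, ← map_smul, ← map_sub,
    ← smul_mul_assoc, ← sub_mul, h, map_zero]

/-- This is the exactness of the Koszul complex of the two commutators in the middle. The two
differences of variables involve disjoint pairs of variables, so the first divides the coefficients
of `w`; the formula for `z` follows by cancelling it. -/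
theorem exists_b_sub_mul (hp : p ≠ 0) (hq : q ≠ 0) {z w : Env k (OSL2 p q)}
    (h : (bi (b p q) 1 - bi 1 (b p q)) * z = (bi (c p q) 1 - bi 1 (c p q)) * w) :
    ∃ y, w = (bi (b p q) 1 - bi 1 (b p q)) * y ∧ z = (bi (c p q) 1 - bi 1 (c p q)) * y := by
  have h1 := congrArg (envEquiv hp hq) h
  simp only [sub_mul, map_sub, envEquiv_b_left, envEquiv_b_right, envEquiv_c_left,
    envEquiv_c_right, ← sub_smul] at h1
  obtain ⟨v, hv⟩ : ∃ v, envEquiv hp hq w = (X (.inl 0) - X (.inr 0) : BCBC k) • v := by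
    refine exists_smul_of_dvd fun i => ?_
    have h2 : (X (.inl 0) - X (.inr 0) : BCBC k) * envEquiv hp hq z i =
        (X (.inl 1) - X (.inr 1)) * envEquiv hp hq w i := DFunLike.congr_fun h1 i
    exact X_sub_X_dvd_of_mul (by simp) (by simp) (by simp) h2
  obtain ⟨y, rfl⟩ := (envEquiv hp hq).surjective v
  have hw : w = (bi (b p q) 1 - bi 1 (b p q)) * y := by
    apply (envEquiv hp hq).injective
    rw [hv, sub_mul, map_sub, envEquiv_b_left, envEquiv_b_right, sub_smul]
  refine ⟨y, hw, ?_⟩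
  rw [← sub_eq_zero]
  refine b_regular hp hq 1 ?_
  have hcomm : (bi (c p q) 1 - bi 1 (c p q) : Env k (OSL2 p q)) * (bi (b p q) 1 - bi 1 (b p q)) =
      (bi (b p q) 1 - bi 1 (b p q)) * (bi (c p q) 1 - bi 1 (c p q)) := by
    simp only [sub_mul, mul_sub, bi_mul_bi, one_mul, mul_one, c_mul_b]
    abel
  rw [one_smul, mul_sub, h, hw, ← mul_assoc, hcomm, mul_assoc, sub_self]

end Regularity

end OSL2

/-! ### The differentials, and the derivatives of the defining relations. -/

namespace OSL2

open MulOpposite TwistedCY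

section EnvLemmas

variable {k A : Type u} [Field k] [Ring A] [Algebra k A]

theorem env_smul_mul (r : k) (x y : Env k A) : (r • x) * y = r • (x * y) := smul_mul_assoc r x y

theorem env_mul_smul (r : k) (x y : Env k A) : x * (r • y) = r • (x * y) := mul_smul_comm r x y

end EnvLemmas

section Complex

variable {k : Type u} [Field k] (p q : k)

/-- The commutator elements `x ⊗ 1 - 1 ⊗ x`. -/
noncomputable def comm (x : OSL2 p q) : Env k (OSL2 p q) := bi x 1 - bi 1 x

/-- The differential from degree one to degree zero. -/
noncomputable def d₁ : Fin 4 → Env k (OSL2 p q) :=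
  ![comm p q (a p q), comm p q (b p q), comm p q (c p q), comm p q (d p q)]

/-- The differential from degree two to degree one. -/
noncomputable def d₂ : Fin 4 → Fin 4 → Env k (OSL2 p q) :=
  ![![1 + bi (b p q) (c p q), (-q) • bi (a p q) (c p q), (-p⁻¹) • bi (b p q) (a p q),
      bi (a p q) (a p q)],
    ![bi (b p q) (d p q), 1 - q • bi (a p q) (d p q), (-p⁻¹) • bi (b p q) (b p q),
      bi (a p q) (b p q)],
    ![bi (d p q) (c p q), (-q) • bi (c p q) (c p q), 1 - p⁻¹ • bi (d p q) (a p q),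
      bi (c p q) (a p q)],
    ![bi (d p q) (d p q), (-q) • bi (c p q) (d p q), (-p⁻¹) • bi (d p q) (b p q),
      1 + bi (c p q) (b p q)]]

/-- The differential from degree three to degree two. -/
noncomputable def d₃ : Fin 4 → Env k (OSL2 p q) :=
  ![(p * q) • bi 1 (d p q) - bi (d p q) 1, q • comm p q (c p q), q • comm p q (b p q),
    bi 1 (a p q) - (p * q) • bi (a p q) 1]

/-- The differentials of the defining relations. -/
noncomputable def relRow : Fin 7 → Fin 4 → Env k (OSL2 p q) :=
  ![![bi (b p q) 1 - q • bi 1 (b p q), bi 1 (a p q) - q • bi (a p q) 1, 0, 0],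
    ![bi (c p q) 1 - p • bi 1 (c p q), 0, bi 1 (a p q) - p • bi (a p q) 1, 0],
    ![0, bi (d p q) 1 - q • bi 1 (d p q), 0, bi 1 (b p q) - q • bi (b p q) 1],
    ![0, 0, bi (d p q) 1 - p • bi 1 (d p q), bi 1 (c p q) - p • bi (c p q) 1],
    ![0, bi 1 (c p q) - bi (c p q) 1, bi (b p q) 1 - bi 1 (b p q), 0],
    ![bi 1 (d p q), (-p⁻¹) • bi 1 (c p q), (-p⁻¹) • bi (b p q) 1, bi (a p q) 1],
    ![bi (d p q) 1, (-q) • bi 1 (c p q), (-q) • bi (b p q) 1, bi 1 (a p q)]]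

/-- The coefficients that express `relRow` through the rows of `d₂`. -/
noncomputable def relCoeff : Fin 7 → Fin 4 → Env k (OSL2 p q) :=
  ![![(-q) • bi 1 (b p q), bi 1 (a p q), 0, 0],
    ![bi (c p q) 1, 0, (-p) • bi (a p q) 1, 0],
    ![0, bi (d p q) 1, 0, (-q) • bi (b p q) 1],
    ![0, 0, (-p) • bi 1 (d p q), bi 1 (c p q)],
    ![(-q⁻¹) • bi (d p q) 1, 0, bi (b p q) 1 - bi 1 (b p q), q⁻¹ • bi 1 (a p q)],
    ![bi 1 (d p q), (-p⁻¹) • bi 1 (c p q), 0, 0],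
    ![bi (d p q) 1, 0, (-q) • bi (b p q) 1, 0]]

variable {p q}

-- With `u` and `v = u⁻¹` as above, the rows of `d₂` are the four entries of `du + u (dv) u`.
-- Multiplying by `v` on the right gives the derivative of `u v = 1`, and on the left that of `v u =
-- 1`. The entries of these two matrices are, up to scalars, the derivatives of the relations other
-- than `b c = c b`. The latter is `q⁻¹` times the difference between entry (2,2) of `u v` and entry
-- (1,1) of `v u`.
set_option maxHeartbeats 1000000 in
theorem relRow_eq (hp : p ≠ 0) (hq : q ≠ 0) (i : Fin 7) (j : Fin 4) :
    relRow p q i j = ∑ r, relCoeff p q i r * d₂ p q r j := by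
  fin_cases i <;> fin_cases j <;>
    simp [relRow, relCoeff, d₂, Fin.sum_univ_four, bi_mul_bi, one_eq_bi, mul_add, add_mul, mul_sub,
      sub_mul, env_smul_mul, env_mul_smul, a_mul_b hq, a_mul_c hp, d_mul_b, d_mul_c, c_mul_b,
      a_mul_d, d_mul_a, smul_smul, hp, hq]
  all_goals try module

end Complex

end OSL2

/-! ### Universal derivations, exactness in low degrees, and the dual complex in degrees 0 and 1. -/

namespace OSL2

open MulOpposite TwistedCY

section Exactness

variable {k : Type u} [Field k] {p q : k}

/-- Vectors killed by the rows of `d₂` satisfy the derivatives of the defining relations. -/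
theorem relRow_smul (hp : p ≠ 0) (hq : q ≠ 0) {N : Type*} [AddCommGroup N]
    [Module (Env k (OSL2 p q)) N] {e : Fin 4 → N} (h : ∀ r, ∑ x, d₂ p q r x • e x = 0)
    (i : Fin 7) : ∑ x, relRow p q i x • e x = 0 := by
  simp only [relRow_eq hp hq, Finset.sum_smul, mul_smul]
  rw [Finset.sum_comm]
  simp [← Finset.smul_sum, h]

section Derivation

variable {N : Type u} [AddCommGroup N] [Module k N] [Module (Env k (OSL2 p q)) N]
  [IsScalarTower k (Env k (OSL2 p q)) N]

/-- The operator on `A × N` defined by an element and a candidate for its derivative. -/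
noncomputable def derOp (x : OSL2 p q) (e : N) : Module.End k (OSL2 p q × N) :=
  LinearMap.prod (LinearMap.mulLeft k x ∘ₗ LinearMap.fst k _ _)
    (Algebra.lsmul k k N (bi x 1 : Env k (OSL2 p q)) ∘ₗ LinearMap.snd k _ _ +
      (LinearMap.toSpanSingleton (Env k (OSL2 p q)) N e).restrictScalars k ∘ₗ
        bi 1 ∘ₗ LinearMap.fst k _ _)

theorem derOp_apply (x : OSL2 p q) (e : N) (y : OSL2 p q × N) :
    derOp x e y = (x * y.1, (bi x 1 : Env k (OSL2 p q)) • y.2 +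
      (bi 1 y.1 : Env k (OSL2 p q)) • e) := rfl

theorem env_smul_assoc (r : k) (x : Env k (OSL2 p q)) (n : N) : (r • x) • n = r • (x • n) :=
  smul_assoc r x n

theorem env_smul_smul_comm (r : k) (x : Env k (OSL2 p q)) (n : N) :
    x • (r • n) = r • (x • n) := by
  have h : r • n = (r • (1 : Env k (OSL2 p q))) • n := by rw [smul_assoc, one_smul]
  rw [h, ← mul_smul, env_mul_smul, mul_one, smul_assoc]

/-- The action of the enveloping algebra, as a linear map. -/
noncomputable def act (x : Env k (OSL2 p q)) : N →ₗ[k] N := Algebra.lsmul k k N x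

theorem smul_eq_act (x : Env k (OSL2 p q)) (n : N) : x • n = act x n := rfl

theorem env_zero_smul (n : N) : (0 : Env k (OSL2 p q)) • n = 0 := zero_smul (Env k (OSL2 p q)) n

theorem act_zero (n : N) : act (0 : Env k (OSL2 p q)) n = 0 := env_zero_smul n

/-- `derOp x e` is left multiplication by `(x, e)` in the square-zero extension `A ⊕ N`. The first
coordinate of each relation is the relation in `A`; the second is its derivative, multiplied on the
right by an element of `A`. Lifting to this extension is how a derivation is built from its values
on generators. -/
theorem isQuad_derOp {e : Fin 4 → N} (h : ∀ i, ∑ x, relRow p q i x • e x = 0) :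
    IsQuad p q (derOp (a p q) (e 0)) (derOp (b p q) (e 1)) (derOp (c p q) (e 2))
      (derOp (d p q) (e 3)) := by
  have key (i : Fin 7) (y : OSL2 p q) :
      (bi 1 y : Env k (OSL2 p q)) • ∑ x, relRow p q i x • e x = 0 := by rw [h, smul_zero]
  constructor
  · refine LinearMap.ext fun y => Prod.ext ?_ ?_
    · simp [derOp_apply, ← mul_assoc, b_mul_a, add_mul]
    · have := key 0 y.1
      simp [relRow, Fin.sum_univ_four, smul_add, smul_smul, bi_mul_bi, sub_smul, add_smul,
        smul_sub, env_smul_assoc, env_smul_smul_comm, env_mul_smul, mul_sub, derOp_apply, b_mul_a,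
        ← one_eq_bi] at this ⊢
      simp only [smul_eq_act, act_zero] at this ⊢
      refine sub_eq_zero.1 (Eq.trans ?_ this)
      module
  · refine LinearMap.ext fun y => Prod.ext ?_ ?_
    · simp [derOp_apply, ← mul_assoc, c_mul_a, add_mul]
    · have := key 1 y.1
      simp [relRow, Fin.sum_univ_four, smul_add, smul_smul, bi_mul_bi, sub_smul, add_smul,
        smul_sub, env_smul_assoc, env_smul_smul_comm, env_mul_smul, mul_sub, derOp_apply, c_mul_a,
        ← one_eq_bi] at this ⊢
      simp only [smul_eq_act, act_zero] at this ⊢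
      refine sub_eq_zero.1 (Eq.trans ?_ this)
      module
  · refine LinearMap.ext fun y => Prod.ext ?_ ?_
    · simp [derOp_apply, ← mul_assoc, d_mul_b, add_mul]
    · have := key 2 y.1
      simp [relRow, Fin.sum_univ_four, smul_add, smul_smul, bi_mul_bi, sub_smul, add_smul,
        smul_sub, env_smul_assoc, env_smul_smul_comm, env_mul_smul, mul_sub, derOp_apply, d_mul_b,
        ← one_eq_bi] at this ⊢
      simp only [smul_eq_act, act_zero] at this ⊢
      refine sub_eq_zero.1 (Eq.trans ?_ this)
      module
  · refine LinearMap.ext fun y => Prod.ext ?_ ?_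
    · simp [derOp_apply, ← mul_assoc, d_mul_c, add_mul]
    · have := key 3 y.1
      simp [relRow, Fin.sum_univ_four, smul_add, smul_smul, bi_mul_bi, sub_smul, add_smul,
        smul_sub, env_smul_assoc, env_smul_smul_comm, env_mul_smul, mul_sub, derOp_apply, d_mul_c,
        ← one_eq_bi] at this ⊢
      simp only [smul_eq_act, act_zero] at this ⊢
      refine sub_eq_zero.1 (Eq.trans ?_ this)
      module
  · refine LinearMap.ext fun y => Prod.ext ?_ ?_
    · simp [derOp_apply, ← mul_assoc, c_mul_b, add_mul]
    · have := key 4 y.1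
      simp [relRow, Fin.sum_univ_four, smul_add, smul_smul, bi_mul_bi, sub_smul, add_smul,
        smul_sub, env_smul_assoc, env_smul_smul_comm, env_mul_smul, mul_sub, derOp_apply, c_mul_b,
        ← one_eq_bi] at this ⊢
      simp only [smul_eq_act, act_zero] at this ⊢
      refine sub_eq_zero.1 (Eq.trans ?_ this)
      module
  · refine LinearMap.ext fun y => Prod.ext ?_ ?_
    · simp [derOp_apply, ← mul_assoc, a_mul_d, add_mul]
    · have := key 5 y.1
      simp [relRow, Fin.sum_univ_four, smul_add, smul_smul, bi_mul_bi, sub_smul, add_smul,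
        smul_sub, env_smul_assoc, env_smul_smul_comm, env_mul_smul, mul_sub, derOp_apply, a_mul_d,
        ← one_eq_bi] at this ⊢
      simp only [smul_eq_act, act_zero] at this ⊢
      refine sub_eq_zero.1 (Eq.trans ?_ this)
      module
  · refine LinearMap.ext fun y => Prod.ext ?_ ?_
    · simp [derOp_apply, ← mul_assoc, d_mul_a, add_mul]
    · have := key 6 y.1
      simp [relRow, Fin.sum_univ_four, smul_add, smul_smul, bi_mul_bi, sub_smul, add_smul,
        smul_sub, env_smul_assoc, env_smul_smul_comm, env_mul_smul, mul_sub, derOp_apply, d_mul_a,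
        ← one_eq_bi] at this ⊢
      simp only [smul_eq_act, act_zero] at this ⊢
      refine sub_eq_zero.1 (Eq.trans ?_ this)
      module

section Universal

variable {e : Fin 4 → N} (h : ∀ i, ∑ x, relRow p q i x • e x = 0)

/-- The derivation with prescribed values on the generators. -/
noncomputable def der : OSL2 p q →ₗ[k] N :=
  LinearMap.snd k _ _ ∘ₗ LinearMap.applyₗ ((1, 0) : OSL2 p q × N) ∘ₗ
    (lift (isQuad_derOp h)).toLinearMap

theorem lift_isQuad_derOp (x : OSL2 p q) : lift (isQuad_derOp h) x = derOp x (der h x) := by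
  -- Evaluating at `(1, 0)` recovers `f`, so it suffices to find the operator in the form `derOp x
  -- f` for some `f`.
  have key {x : OSL2 p q} {f : N} (hx : lift (isQuad_derOp h) x = derOp x f) :
      lift (isQuad_derOp h) x = derOp x (der h x) := by
    have : der h x = f := by
      change (lift (isQuad_derOp h) x (1, 0)).2 = f
      simp [hx, derOp_apply, ← one_eq_bi]
    rw [this, hx]
  induction x using induction_gen with
  | h0 r =>
    refine key (f := 0) (LinearMap.ext fun y => ?_)
    simp [derOp_apply, Algebra.algebraMap_eq_smul_one, ← one_eq_bi, env_smul_assoc, Prod.smul_def]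
  | ha => exact key (lift_a _)
  | hb => exact key (lift_b _)
  | hc => exact key (lift_c _)
  | hd => exact key (lift_d _)
  | hadd x y hx hy =>
    rw [map_add, map_add, hx, hy]
    refine LinearMap.ext fun z => ?_
    simp only [LinearMap.add_apply, derOp_apply, map_add, add_mul, add_smul, smul_add,
      Prod.mk_add_mk]
    congr 1
    abel
  | hmul x y hx hy =>
    refine key (f := (bi x 1 : Env k (OSL2 p q)) • der h y +
      (bi 1 y : Env k (OSL2 p q)) • der h x) (LinearMap.ext fun z => ?_)
    rw [map_mul, hx, hy]
    simp only [Module.End.mul_apply, derOp_apply, smul_add, smul_smul, bi_mul_bi, mul_assoc,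
      one_mul, mul_one]
    congr 1
    abel

theorem der_mul (x y : OSL2 p q) : der h (x * y) =
    (bi x 1 : Env k (OSL2 p q)) • der h y + (bi 1 y : Env k (OSL2 p q)) • der h x := by
  have := congrArg Prod.snd (LinearMap.congr_fun (lift_isQuad_derOp h (x * y)) (1, 0))
  rw [map_mul, lift_isQuad_derOp, lift_isQuad_derOp] at this
  simpa [derOp_apply, ← one_eq_bi] using this.symm

theorem der_gen {x : OSL2 p q} {f : N} (hx : lift (isQuad_derOp h) x = derOp x f) :
    der h x = f := by
  change (lift (isQuad_derOp h) x (1, 0)).2 = f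
  simp [hx, derOp_apply, ← one_eq_bi]

/-- The map on the enveloping algebra induced by a derivation. -/
noncomputable def derExt : Env k (OSL2 p q) →ₗ[k] N :=
  TensorProduct.lift (LinearMap.mk₂ k
    (fun x y => (bi 1 y.unop : Env k (OSL2 p q)) • der h x)
    (fun x x' y => by simp) (fun r x y => by simp [env_smul_smul_comm])
    (fun x y y' => by simp [add_smul]) (fun r x y => by simp [env_smul_assoc]))

theorem derExt_bi (x y : OSL2 p q) :
    derExt h (bi x y) = (bi 1 y : Env k (OSL2 p q)) • der h x := rfl

/-- The map `x ⊗ y ↦ D(x) y` is not claimed to be linear over `E`, but by the Leibniz rule the terms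
that obstruct linearity cancel on multiples of commutators. -/
theorem derExt_mul_comm (z : Env k (OSL2 p q)) (x : OSL2 p q) :
    derExt h (z * comm p q x) = z • der h x := by
  induction z using env_induction with
  | h0 => rw [env_zero_smul, zero_mul, map_zero]
  | hadd z w hz hw => rw [add_mul, map_add, hz, hw, add_smul]
  | hb y y' =>
    simp only [comm, mul_sub, bi_mul_bi, mul_one, one_mul, map_sub, derExt_bi, der_mul, smul_add,
      smul_smul]
    simp

theorem derExt_d₁ (z : Env k (OSL2 p q)) (i : Fin 4) :
    derExt h (z * d₁ p q i) = z • e i := by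
  fin_cases i <;> simp only [d₁] <;> refine (derExt_mul_comm h _ _).trans ?_ <;> congr 1 <;>
    apply der_gen
  exacts [lift_a _, lift_b _, lift_c _, lift_d _]

end Universal

end Derivation

/-- Exactness in degree one. -/
theorem exists_of_sum_d₁ (hp : p ≠ 0) (hq : q ≠ 0) {y : Fin 4 → Env k (OSL2 p q)}
    (hy : ∑ i, y i * d₁ p q i = 0) : 
    ∃ z : Fin 4 → Env k (OSL2 p q), y = ∑ r, z r • d₂ p q r := by
  -- In the cokernel of `d₂` the basis vectors satisfy the derivatives of all relations, so a
  -- derivation with these values on the generators exists.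
  let S : Submodule (Env k (OSL2 p q)) (Fin 4 → Env k (OSL2 p q)) :=
    Submodule.span _ (Set.range (d₂ p q))
  let e : Fin 4 → (Fin 4 → Env k (OSL2 p q)) ⧸ S := fun i => S.mkQ (Pi.single i 1)
  have hS (w : Fin 4 → Env k (OSL2 p q)) : ∑ i, w i • e i = S.mkQ w := by
    simp only [e, ← map_smul, ← map_sum]
    congr 1
    ext j
    simp [Finset.sum_apply, Pi.single_apply]
  have h := relRow_smul hp hq (e := e) fun r => by
    rw [hS]
    exact (Submodule.Quotient.mk_eq_zero _).2 (Submodule.subset_span ⟨r, rfl⟩)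
  have h0 : S.mkQ y = 0 := by
    rw [← hS]
    -- The class of `y` is the value of `derExt` at `∑ i, y i * d₁ p q i`, which is 0.
    simp only [← derExt_d₁ h, ← map_sum, hy, map_zero]
  have h1 : y ∈ S := (Submodule.Quotient.mk_eq_zero _).1 h0
  obtain ⟨z, hz⟩ := (Submodule.mem_span_range_iff_exists_fun _).1 h1
  exact ⟨z, hz.symm⟩

variable (p q) in
/-- Elements whose commutator lies in the left ideal generated by the entries of `d₁`. -/
theorem comm_mem_span (x : OSL2 p q) : comm p q x ∈ Ideal.span (Set.range (d₁ p q)) := by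
  induction x using induction_gen with
  | h0 r => simp [comm, Algebra.algebraMap_eq_smul_one]
  | ha => exact Ideal.subset_span ⟨0, rfl⟩
  | hb => exact Ideal.subset_span ⟨1, rfl⟩
  | hc => exact Ideal.subset_span ⟨2, rfl⟩
  | hd => exact Ideal.subset_span ⟨3, rfl⟩
  | hadd x y hx hy =>
    have : comm p q (x + y) = comm p q x + comm p q y := by
      simp [comm]; abel
    rw [this]
    exact add_mem hx hy
  | hmul x y hx hy =>
    have : comm p q (x * y) = bi x 1 * comm p q y + bi 1 y * comm p q x := by
      simp only [comm, mul_sub, bi_mul_bi, one_mul, mul_one]; abel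
    rw [this]
    exact add_mem (Ideal.mul_mem_left _ _ hy) (Ideal.mul_mem_left _ _ hx)

variable (k) in
/-- The multiplication map of an algebra. -/
noncomputable def mulMap (A : Type u) [Ring A] [Algebra k A] : Env k A →ₗ[Env k A] A :=
  LinearMap.toSpanSingleton (Env k A) A 1

theorem mulMap_bi {A : Type u} [Ring A] [Algebra k A] (x y : A) :
    mulMap k A (bi x y) = x * y := by
  simp [mulMap, bi_apply, regular_smul]

theorem mulMap_d₁ (i : Fin 4) : mulMap k _ (d₁ p q i) = 0 := by
  fin_cases i <;> simp [d₁, comm, mulMap_bi]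

/-- Exactness in degree zero. -/
theorem exists_of_mulMap (z : Env k (OSL2 p q)) (hz : mulMap k _ z = 0) :
    ∃ y : Fin 4 → Env k (OSL2 p q), z = ∑ i, y i * d₁ p q i := by
  -- Modulo the left ideal of commutators every tensor `x ⊗ y` can be moved to `1 ⊗ x y`, so only
  -- its product survives.
  have h (z : Env k (OSL2 p q)) :
      z - bi 1 (mulMap k _ z) ∈ Ideal.span (Set.range (d₁ p q)) := by
    induction z using env_induction with
    | h0 => simp
    | hadd z w hz hw =>
      rw [map_add, map_add, add_sub_add_comm]
      exact add_mem hz hw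
    | hb x y =>
      have : (bi x y - bi 1 (mulMap k _ (bi x y)) : Env k (OSL2 p q)) =
          bi 1 y * comm p q x := by
        simp [comm, mul_sub, bi_mul_bi, mulMap_bi]
      rw [this]
      exact Ideal.mul_mem_left _ _ (comm_mem_span p q x)
  have h1 := h z
  rw [hz, map_zero, sub_zero] at h1
  obtain ⟨y, hy⟩ := (Submodule.mem_span_range_iff_exists_fun _).1 h1
  exact ⟨y, hy.symm⟩

/-- There are no central elements in the outer bimodule. -/
theorem eq_zero_of_d₁_mul (hp : p ≠ 0) (hq : q ≠ 0) {w : Env k (OSL2 p q)}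
    (h : ∀ i, d₁ p q i * w = 0) : w = 0 := by
  refine b_regular hp hq 1 ?_
  rw [one_smul]
  exact h 1

/-- `x ↦ x ⊗ 1 - 1 ⊗ x` is a derivation, so it respects the differentiated relations. This allows
inner derivations to be subtracted in the next proof. -/
theorem relRow_mul_d₁ (hp : p ≠ 0) (hq : q ≠ 0) (i : Fin 7) :
    ∑ x, relRow p q i x * d₁ p q x = 0 := by
  fin_cases i <;>
    simp [relRow, d₁, comm, Fin.sum_univ_four, bi_mul_bi, one_eq_bi, mul_add, add_mul, mul_sub,
      sub_mul, env_smul_mul, env_mul_smul, a_mul_b hq, a_mul_c hp, d_mul_b, d_mul_c, c_mul_b,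
      a_mul_d, d_mul_a, smul_smul, hp, hq]
  all_goals try module

/-- Derivations into the outer bimodule are inner. -/
theorem exists_of_d₂_mul (hp : p ≠ 0) (hq : q ≠ 0) {f : Fin 4 → Env k (OSL2 p q)}
    (hf : ∀ r, ∑ x, d₂ p q r x * f x = 0) : ∃ w, ∀ x, f x = d₁ p q x * w := by
  have hr (i : Fin 7) : ∑ x, relRow p q i x * f x = 0 := relRow_smul hp hq hf i
  -- The derivative of `b c = c b` is the Koszul condition on the values at `b` and `c`, so on these
  -- two generators the derivation is inner.
  obtain ⟨w, hb, hc⟩ := exists_b_sub_mul hp hq (z := f 2) (w := f 1) (by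
    have := hr 4
    simp [relRow, Fin.sum_univ_four] at this
    rw [← sub_eq_zero, ← this]
    simp only [sub_mul]
    abel)
  refine ⟨w, fun i => ?_⟩
  let g : Fin 4 → Env k (OSL2 p q) := fun x => f x - d₁ p q x * w
  have hg1 : g 1 = 0 := sub_eq_zero.2 hb
  have hg2 : g 2 = 0 := sub_eq_zero.2 hc
  have hrg (i : Fin 7) : ∑ x, relRow p q i x * g x = 0 := by
    simp only [g, mul_sub, ← mul_assoc, Finset.sum_sub_distrib, hr, ← Finset.sum_mul,
      relRow_mul_d₁ hp hq, zero_mul, sub_zero]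
  -- Once the values at `b` and `c` vanish, the relation between `b` and `a` says that `b ⊗ 1 - q (1
  -- ⊗ b)` kills the value at `a`. The relation between `d` and `b` treats `d` in the same way,
  -- after division by `-q`.
  have hg0 : g 0 = 0 := by
    refine b_regular hp hq q ?_
    have := hrg 0
    simpa [relRow, Fin.sum_univ_four, hg1, hg2] using this
  have hg3 : g 3 = 0 := by
    refine b_regular hp hq q⁻¹ ?_
    have := congrArg (fun z => -q⁻¹ • z) (hrg 2)
    simp only [relRow, Fin.sum_univ_four, hg0, hg1, hg2] at this
    simpa [← env_smul_mul, smul_sub, smul_smul, hq, neg_add_eq_sub] using this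
  refine sub_eq_zero.1 (show g i = 0 from ?_)
  fin_cases i
  exacts [hg0, hg1, hg2, hg3]

end Exactness

end OSL2

/-! ### The twisted flip, an anti-automorphism of the enveloping algebra. -/

namespace TwistedCY

open MulOpposite

section TwistedFlip

variable {k A : Type u} [Field k] [Ring A] [Algebra k A] (μ : A ≃ₐ[k] A)

/-- The twisted flip `x ⊗ op y ↦ y ⊗ op (μ x)` of the enveloping algebra. -/
noncomputable def flip : Env k A ≃ₗ[k] Env k A :=
  TensorProduct.comm k A Aᵐᵒᵖ ≪≫ₗ
    TensorProduct.congr (opLinearEquiv k).symm (μ.toLinearEquiv ≪≫ₗ opLinearEquiv k)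

theorem flip_bi (x y : A) : flip μ (bi x y) = bi y (μ x) := rfl

theorem flip_one : flip μ 1 = 1 := by
  exact congrArg (bi (1 : A)) (map_one μ)

theorem flip_mul (z w : Env k A) : flip μ (z * w) = flip μ w * flip μ z := by
  induction z using env_induction with
  | h0 => simp
  | hadd z z' hz hz' => rw [add_mul, map_add, hz, hz', map_add, mul_add]
  | hb x y =>
    induction w using env_induction with
    | h0 => simp
    | hadd z z' hz hz' => rw [mul_add, map_add, hz, hz', map_add, add_mul]
    | hb x' y' => simp only [bi_mul_bi, flip_bi, map_mul]

end TwistedFlip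

end TwistedCY

/-! ### Self-duality of the complex and the remaining exactness. -/

namespace OSL2

open MulOpposite TwistedCY

section Duality

variable {k : Type u} [Field k] {p q : k}

theorem inv_mul_self (hp : p ≠ 0) (hq : q ≠ 0) : (p * q)⁻¹ * (p * q) = 1 :=
  inv_mul_cancel₀ (mul_ne_zero hp hq)

variable (p q) in
/-- The Nakayama automorphism. -/
noncomputable def nakayama (hp : p ≠ 0) (hq : q ≠ 0) : OSL2 p q ≃ₐ[k] OSL2 p q :=
  scale (p * q)⁻¹ (p * q) (inv_mul_self hp hq)

variable (p q) in
/-- The scalars in the self-duality of the resolution. -/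
def dualScalar : Fin 4 → k := ![p * q, -q, -q, 1]

theorem dualScalar_ne_zero (hp : p ≠ 0) (hq : q ≠ 0) (r : Fin 4) : dualScalar p q r ≠ 0 := by
  fin_cases r <;> simp [dualScalar, hp, hq]

section
variable (hp : p ≠ 0) (hq : q ≠ 0)

theorem flip_d₃ (r : Fin 4) :
    flip (nakayama p q hp hq) (d₃ p q r) = dualScalar p q r • d₁ p q r.rev := by
  fin_cases r <;>
    simp [Fin.rev, d₃, d₁, dualScalar, comm, flip_bi, nakayama, smul_sub, smul_smul, hp, hq,
      mul_assoc, mul_left_comm p q, mul_comm q p]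
  all_goals module

/-- The flip sends the matrix of `d₂` to its transpose across the antidiagonal, after conjugation by
the diagonal matrix of dual scalars. Together with `flip_d₃` this is where the twist by `μ` is
forced: `d₃` is matched with true commutators only because `μ` scales `a` and `d` by these factors.
-/
theorem flip_d₂ (r x : Fin 4) :
    dualScalar p q r • flip (nakayama p q hp hq) (d₂ p q r x) =
      dualScalar p q x • d₂ p q x.rev r.rev := by
  fin_cases r <;> fin_cases x <;>
    simp [Fin.rev, d₂, dualScalar, flip_bi, flip_one, nakayama, smul_sub, smul_add,
      smul_smul, hp, hq, mul_assoc]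
  all_goals (match_scalars <;> field_simp)

end

theorem d₂_mul_d₁ (hp : p ≠ 0) (hq : q ≠ 0) (r : Fin 4) : ∑ x, d₂ p q r x * d₁ p q x = 0 := by
  fin_cases r <;>
    simp [d₂, d₁, comm, Fin.sum_univ_four, bi_mul_bi, one_eq_bi, mul_add, add_mul, mul_sub,
      sub_mul, env_smul_mul, env_mul_smul, a_mul_b hq, a_mul_c hp, d_mul_b, d_mul_c, c_mul_b,
      a_mul_d, d_mul_a, smul_smul, hp, hq]
  all_goals try module

theorem d₃_mul_d₂ (hp : p ≠ 0) (hq : q ≠ 0) (x : Fin 4) : ∑ r, d₃ p q r * d₂ p q r x = 0 := by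
  fin_cases x <;>
    simp [d₂, d₃, comm, Fin.sum_univ_four, bi_mul_bi, one_eq_bi, mul_add, add_mul, mul_sub,
      sub_mul, env_smul_mul, env_mul_smul, a_mul_b hq, a_mul_c hp, d_mul_b, d_mul_c, c_mul_b,
      a_mul_d, d_mul_a, smul_smul, hp, hq]
  all_goals (match_scalars <;> field_simp <;> ring)

/-- Injectivity in degree three. -/
theorem eq_zero_of_mul_d₃ (hp : p ≠ 0) (hq : q ≠ 0) {w : Env k (OSL2 p q)}
    (h : ∀ r, w * d₃ p q r = 0) : w = 0 := by
  apply (flip (nakayama p q hp hq)).injective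
  rw [map_zero]
  -- The flip reverses products, so annihilation of `d₃` from the left becomes annihilation of `d₁`
  -- from the right.
  refine eq_zero_of_d₁_mul hp hq fun i => ?_
  have h1 := congrArg (flip (nakayama p q hp hq)) (h i.rev)
  rw [flip_mul, flip_d₃, Fin.rev_rev, env_smul_mul, map_zero] at h1
  exact (smul_eq_zero.1 h1).resolve_left (dualScalar_ne_zero hp hq _)

theorem flip_d₂_eq (hp : p ≠ 0) (hq : q ≠ 0) (r x : Fin 4) :
    flip (nakayama p q hp hq) (d₂ p q r x) =
      ((dualScalar p q r)⁻¹ * dualScalar p q x) • d₂ p q x.rev r.rev := by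
  rw [mul_smul, ← flip_d₂, inv_smul_smul₀ (dualScalar_ne_zero hp hq r)]

/-- Exactness in degree two. -/
theorem exists_of_sum_d₂ (hp : p ≠ 0) (hq : q ≠ 0) {z : Fin 4 → Env k (OSL2 p q)}
    (h : ∀ x, ∑ r, z r * d₂ p q r x = 0) : ∃ w, ∀ r, z r = w * d₃ p q r := by
  -- The inverse scalars cancel those in `flip_d₂_eq`, so that `f` is a genuine cocycle of the dual
  -- complex in degree one.
  let f : Fin 4 → Env k (OSL2 p q) := fun r =>
    (dualScalar p q r.rev)⁻¹ • flip (nakayama p q hp hq) (z r.rev)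
  obtain ⟨w, hw⟩ := exists_of_d₂_mul hp hq (f := f) fun x => by
    have h1 := congrArg (flip (nakayama p q hp hq)) (h x.rev)
    simp only [map_sum, flip_mul, flip_d₂_eq, map_zero, env_smul_mul, Fin.rev_rev] at h1
    rw [← Equiv.sum_comp Fin.revPerm] at h1
    have h2 : dualScalar p q x.rev • ∑ i, d₂ p q x i * f i = 0 := by
      rw [← h1, Finset.smul_sum]
      refine Finset.sum_congr rfl fun i _ => ?_
      simp only [f, env_mul_smul, smul_smul, Fin.revPerm_apply, Fin.rev_rev, mul_comm]
    exact (smul_eq_zero.1 h2).resolve_left (dualScalar_ne_zero hp hq _)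
  refine ⟨(flip (nakayama p q hp hq)).symm w, fun r => ?_⟩
  apply (flip (nakayama p q hp hq)).injective
  rw [flip_mul, LinearEquiv.apply_symm_apply, flip_d₃, env_smul_mul, ← hw]
  simp only [f, Fin.rev_rev, smul_inv_smul₀ (dualScalar_ne_zero hp hq r)]

/-- Exactness of the dual complex in degree two. -/
theorem exists_of_sum_d₃ (hp : p ≠ 0) (hq : q ≠ 0) {f : Fin 4 → Env k (OSL2 p q)}
    (h : ∑ r, d₃ p q r * f r = 0) :
    ∃ g : Fin 4 → Env k (OSL2 p q), ∀ r, f r = ∑ x, d₂ p q r x * g x := by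
  let y : Fin 4 → Env k (OSL2 p q) := fun r =>
    dualScalar p q r.rev • flip (nakayama p q hp hq) (f r.rev)
  obtain ⟨z, hz⟩ := exists_of_sum_d₁ hp hq (y := y) (by
    have h1 := congrArg (flip (nakayama p q hp hq)) h
    simp only [map_sum, flip_mul, flip_d₃, map_zero, env_mul_smul] at h1
    rw [← h1, ← Equiv.sum_comp Fin.revPerm]
    refine Finset.sum_congr rfl fun i _ => ?_
    simp only [y, env_smul_mul, Fin.revPerm_apply, Fin.rev_rev])
  refine ⟨fun x => (flip (nakayama p q hp hq)).symm ((dualScalar p q x)⁻¹ • z x.rev),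
    fun r => ?_⟩
  apply (flip (nakayama p q hp hq)).injective
  have hr : dualScalar p q r • flip (nakayama p q hp hq) (f r) =
      ∑ x, z x * d₂ p q x r.rev := by
    have := congrFun hz r.rev
    simpa [y, Finset.sum_apply] using this
  rw [← smul_right_inj (dualScalar_ne_zero hp hq r), hr, map_sum, Finset.smul_sum,
    ← Equiv.sum_comp Fin.revPerm]
  refine Finset.sum_congr rfl fun x _ => ?_
  rw [flip_mul, LinearEquiv.apply_symm_apply, flip_d₂_eq, env_mul_smul, env_smul_mul, smul_smul,
    smul_smul, mul_inv_cancel_left₀ (dualScalar_ne_zero hp hq r),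
    mul_inv_cancel₀ (dualScalar_ne_zero hp hq x), one_smul, Fin.revPerm_apply]

/-- The cokernel of the last map of the dual complex. -/
theorem mulMap_flip_eq_zero_iff (hp : p ≠ 0) (hq : q ≠ 0) (z : Env k (OSL2 p q)) :
    mulMap k _ (flip (nakayama p q hp hq) z) = 0 ↔
      ∃ f : Fin 4 → Env k (OSL2 p q), z = ∑ r, d₃ p q r * f r := by
  constructor
  · intro h
    obtain ⟨y, hy⟩ := exists_of_mulMap _ h
    refine ⟨fun r => (flip (nakayama p q hp hq)).symm ((dualScalar p q r)⁻¹ • y r.rev), ?_⟩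
    apply (flip (nakayama p q hp hq)).injective
    rw [hy, map_sum, ← Equiv.sum_comp Fin.revPerm]
    refine Finset.sum_congr rfl fun r _ => ?_
    rw [flip_mul, LinearEquiv.apply_symm_apply, flip_d₃, env_mul_smul, env_smul_mul, smul_smul,
      mul_inv_cancel₀ (dualScalar_ne_zero hp hq r), one_smul, Fin.revPerm_apply]
  · rintro ⟨f, rfl⟩
    rw [map_sum, map_sum]
    refine Finset.sum_eq_zero fun r _ => ?_
    rw [flip_mul, flip_d₃, env_mul_smul, ← env_smul_mul]
    exact (map_smul (mulMap k _) _ _).trans ((congrArg _ (mulMap_d₁ _)).trans (smul_zero _))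

end Duality

end OSL2

/-! ### Projective resolutions from exact sequences. -/

namespace TwistedCY

section Resolution

open Limits

section

variable {C : Type*} [Category C] [Abelian C] {Z : C} (X : ℕ → C)
  (d : ∀ n, X (n + 1) ⟶ X n) (sq : ∀ n, d (n + 1) ≫ d n = 0) (ε : X 0 ⟶ Z) (hε : d 0 ≫ ε = 0)

theorem chainComplex_of_d (n : ℕ) : (ChainComplex.of X d sq).d (n + 1) n = d n :=
  ChainComplex.of_d X d n

/-- The augmentation of a complex, as a chain map. -/
noncomputable def augmentation : ChainComplex.of X d sq ⟶ (ChainComplex.single₀ C).obj Z :=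
  (ChainComplex.toSingle₀Equiv _ _).symm
    ⟨ε, (congrArg (· ≫ ε) (chainComplex_of_d X d sq 0)).trans hε⟩

theorem augmentation_f_zero : (augmentation X d sq ε hε).f 0 = ε :=
  ChainComplex.toSingle₀Equiv_symm_apply_f_zero _ _

theorem quasiIso_augmentation (hexact : ∀ n, (ShortComplex.mk _ _ (sq n)).Exact)
    (hexact₀ : (ShortComplex.mk _ _ hε).Exact) (hepi : Epi ε) :
    QuasiIso (augmentation X d sq ε hε) := by
  refine ⟨fun n => ?_⟩
  cases n with
  | zero =>
    -- In degree zero, being a quasi-isomorphism onto a single object means that the augmentation is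
    -- an epimorphism and the sequence is exact at `X 0`.
    rw [ChainComplex.quasiIsoAt₀_iff, ShortComplex.quasiIso_iff_of_zeros' _ rfl rfl rfl]
    refine (ShortComplex.exact_and_epi_g_iff_of_iso ?_).2 ⟨hexact₀, hepi⟩
    exact ShortComplex.isoMk (Iso.refl _) (Iso.refl _) (Iso.refl _)
      ((Category.id_comp _).trans
        ((chainComplex_of_d X d sq 0).symm.trans (Category.comp_id _).symm))
      ((Category.id_comp _).trans
        ((augmentation_f_zero X d sq ε hε).symm.trans (Category.comp_id _).symm))
  | succ n =>
    rw [quasiIsoAt_iff_exactAt' _ _ (ChainComplex.exactAt_succ_single_obj _ _),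
      HomologicalComplex.exactAt_iff' _ (n + 1 + 1) (n + 1) n (by simp) (by simp)]
    refine (ShortComplex.exact_iff_of_iso ?_).2 (hexact n)
    exact ShortComplex.isoMk (Iso.refl _) (Iso.refl _) (Iso.refl _)
      ((Category.id_comp _).trans
        ((chainComplex_of_d X d sq (n + 1)).symm.trans (Category.comp_id _).symm))
      ((Category.id_comp _).trans
        ((chainComplex_of_d X d sq n).symm.trans (Category.comp_id _).symm))

/-- A projective resolution from an exact sequence of projective objects. -/
noncomputable def resolutionOf (hX : ∀ n, Projective (X n))
    (hexact : ∀ n, (ShortComplex.mk _ _ (sq n)).Exact)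
    (hexact₀ : (ShortComplex.mk _ _ hε).Exact) (hepi : Epi ε) : ProjectiveResolution Z where
  complex := ChainComplex.of X d sq
  projective := hX
  π := augmentation X d sq ε hε
  quasiIso := quasiIso_augmentation X d sq ε hε hexact hexact₀ hepi

end

end Resolution

end TwistedCY

/-! ### The free bimodule resolution and smoothness. -/

namespace OSL2

open MulOpposite TwistedCY

section FreeResolution

variable {k : Type u} [Field k] (p q : k)

/-- The terms of the free resolution. -/
noncomputable def resX : ℕ → ModuleCat.{u} (Env k (OSL2 p q))
  | 0 => ModuleCat.of _ (Env k (OSL2 p q))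
  | 1 => ModuleCat.of _ (Fin 4 → Env k (OSL2 p q))
  | 2 => ModuleCat.of _ (Fin 4 → Env k (OSL2 p q))
  | 3 => ModuleCat.of _ (Env k (OSL2 p q))
  | _ + 4 => ModuleCat.of _ PUnit.{u + 1}

/-- The differentials of the free resolution. -/
noncomputable def resD : ∀ n, resX p q (n + 1) ⟶ resX p q n
  | 0 => ModuleCat.ofHom (Fintype.linearCombination (Env k (OSL2 p q)) (d₁ p q))
  | 1 => ModuleCat.ofHom (Fintype.linearCombination (Env k (OSL2 p q)) (d₂ p q))
  | 2 => ModuleCat.ofHom (LinearMap.toSpanSingleton (Env k (OSL2 p q)) _ (d₃ p q))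
  | _ + 3 => 0

/-- The augmentation of the free resolution. -/
noncomputable def resε : resX p q 0 ⟶ ModuleCat.of (Env k (OSL2 p q)) (OSL2 p q) :=
  ModuleCat.ofHom (mulMap k (OSL2 p q))

variable {p q}

theorem resD_resε : resD p q 0 ≫ resε p q = 0 := by
  refine ModuleCat.hom_ext (LinearMap.ext fun y => ?_)
  change mulMap k _ (∑ i, y i * d₁ p q i) = 0
  simp only [← smul_eq_mul, map_sum, map_smul, mulMap_d₁, smul_zero, Finset.sum_const_zero]

theorem resD_resD (hp : p ≠ 0) (hq : q ≠ 0) (n : ℕ) : resD p q (n + 1) ≫ resD p q n = 0 := by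
  match n with
  | 0 =>
    refine ModuleCat.hom_ext (LinearMap.ext fun y => ?_)
    change ∑ x, (∑ r, y r • d₂ p q r) x * d₁ p q x = 0
    simp only [Finset.sum_apply, Pi.smul_apply, smul_eq_mul, Finset.sum_mul]
    rw [Finset.sum_comm]
    simp only [mul_assoc, ← Finset.mul_sum, d₂_mul_d₁ hp hq, mul_zero, Finset.sum_const_zero]
  | 1 =>
    refine ModuleCat.hom_ext (LinearMap.ext fun y => funext fun x => ?_)
    have h (y : Env k (OSL2 p q)) : (∑ r, (y * d₃ p q r) • d₂ p q r) x = 0 := by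
      simp only [Finset.sum_apply, Pi.smul_apply, smul_eq_mul, mul_assoc, ← Finset.mul_sum,
        d₃_mul_d₂ hp hq, mul_zero]
    exact h y
  | 2 => exact Limits.zero_comp
  | n + 3 => exact Limits.zero_comp

theorem projective_resX (n : ℕ) : Projective (resX p q n) := by
  match n with
  | 0 => exact (IsProjective.iff_projective (Env k (OSL2 p q))).1 inferInstance
  | 1 => exact (IsProjective.iff_projective (Fin 4 → Env k (OSL2 p q))).1 inferInstance
  | 2 => exact (IsProjective.iff_projective (Fin 4 → Env k (OSL2 p q))).1 inferInstance
  | 3 => exact (IsProjective.iff_projective (Env k (OSL2 p q))).1 inferInstance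
  | n + 4 => exact (IsProjective.iff_projective PUnit.{u + 1}).1 inferInstance

theorem finite_resX (n : ℕ) : Module.Finite (Env k (OSL2 p q)) (resX p q n) := by
  match n with
  | 0 => exact inferInstanceAs (Module.Finite _ (Env k (OSL2 p q)))
  | 1 => exact inferInstanceAs (Module.Finite _ (Fin 4 → Env k (OSL2 p q)))
  | 2 => exact inferInstanceAs (Module.Finite _ (Fin 4 → Env k (OSL2 p q)))
  | 3 => exact inferInstanceAs (Module.Finite _ (Env k (OSL2 p q)))
  | n + 4 => exact inferInstanceAs (Module.Finite _ PUnit.{u + 1})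

theorem exact_resD (hp : p ≠ 0) (hq : q ≠ 0) (n : ℕ) :
    (ShortComplex.mk _ _ (resD_resD (p := p) (q := q) hp hq n)).Exact := by
  rw [ShortComplex.moduleCat_exact_iff]
  match n with
  | 0 =>
    intro y hy
    obtain ⟨z, hz⟩ := exists_of_sum_d₁ hp hq (y := y) hy
    exact ⟨z, hz.symm⟩
  | 1 =>
    intro y hy
    obtain ⟨w, hw⟩ := exists_of_sum_d₂ hp hq (z := y) fun x => by
      have : (∑ r, (show Fin 4 → Env k (OSL2 p q) from y) r • d₂ p q r) x = 0 := congrFun hy x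
      simpa [Finset.sum_apply] using this
    exact ⟨w, funext fun r => (hw r).symm⟩
  | 2 =>
    intro y hy
    refine ⟨0, ?_⟩
    rw [map_zero]
    exact (eq_zero_of_mul_d₃ hp hq (w := y) fun r => congrFun hy r).symm
  | n + 3 => exact fun y _ => ⟨0, Subsingleton.elim (α := PUnit) _ _⟩

theorem exact_resε : (ShortComplex.mk _ _ (resD_resε (p := p) (q := q))).Exact := by
  rw [ShortComplex.moduleCat_exact_iff]
  intro z hz
  obtain ⟨y, hy⟩ := exists_of_mulMap z hz
  exact ⟨y, hy.symm⟩

theorem epi_resε : Epi (resε p q) := by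
  rw [ModuleCat.epi_iff_surjective]
  exact fun x => ⟨bi x 1, (mulMap_bi x 1).trans (mul_one x)⟩

/-- The free bimodule resolution. -/
noncomputable def resolution (hp : p ≠ 0) (hq : q ≠ 0) :
    ProjectiveResolution (ModuleCat.of (Env k (OSL2 p q)) (OSL2 p q)) :=
  resolutionOf (resX p q) (resD p q) (resD_resD hp hq) (resε p q) resD_resε projective_resX
    (exact_resD hp hq) exact_resε epi_resε

theorem resolution_d (hp : p ≠ 0) (hq : q ≠ 0) (n : ℕ) :
    (resolution hp hq).complex.d (n + 1) n = resD p q n :=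
  chainComplex_of_d _ _ (resD_resD hp hq) n

theorem isSmooth (hp : p ≠ 0) (hq : q ≠ 0) : IsSmooth k (OSL2 p q) := by
  refine ⟨resolution hp hq, finite_resX, 3, fun i hi => ?_⟩
  obtain ⟨n, rfl⟩ : ∃ n, i = n + 4 := ⟨i - 4, by omega⟩
  have : Subsingleton (ModuleCat.of (Env k (OSL2 p q)) PUnit.{u + 1}) :=
    inferInstanceAs (Subsingleton PUnit)
  exact ModuleCat.isZero_of_subsingleton (ModuleCat.of (Env k (OSL2 p q)) PUnit.{u + 1})

end FreeResolution

end OSL2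

/-! ### Computation of the Hochschild cohomology. -/

namespace OSL2

open MulOpposite TwistedCY

section Cohomology

variable {k : Type u} [Field k] {p q : k}

/-- The cohomology class of a cocycle. -/
noncomputable def classOf (hp : p ≠ 0) (hq : q ≠ 0) {n : ℕ}
    (f : resX p q n ⟶ ModuleCat.of (Env k (OSL2 p q)) (Env k (OSL2 p q)))
    (hf : resD p q n ≫ f = 0) : HH k (OSL2 p q) n :=
  (resolution hp hq).extMk f (n + 1) rfl
    ((congrArg (· ≫ f) (resolution_d hp hq n)).trans hf)

theorem classOf_surjective (hp : p ≠ 0) (hq : q ≠ 0) {n : ℕ} (α : HH k (OSL2 p q) n) :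
    ∃ f hf, classOf hp hq f hf = α := by
  obtain ⟨f, hf, h⟩ := (resolution hp hq).extMk_surjective α (n + 1) rfl
  exact ⟨f, (congrArg (· ≫ f) (resolution_d hp hq n)).symm.trans hf, h⟩

theorem classOf_eq_zero_iff (hp : p ≠ 0) (hq : q ≠ 0) {n : ℕ}
    (f : resX p q (n + 1) ⟶ ModuleCat.of (Env k (OSL2 p q)) (Env k (OSL2 p q)))
    (hf : resD p q (n + 1) ≫ f = 0) :
    classOf hp hq f hf = 0 ↔ ∃ g, resD p q n ≫ g = f := by
  refine ((resolution hp hq).extMk_eq_zero_iff f (n + 2) rfl _ n rfl).trans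
    (exists_congr fun g => ?_)
  exact iff_of_eq (congrArg (· = f) (congrArg (· ≫ g) (resolution_d hp hq n)))

/-- The homomorphism from a free module of rank four with given values on the basis. -/
noncomputable def homOfVec (g : Fin 4 → Env k (OSL2 p q)) :
    ModuleCat.of (Env k (OSL2 p q)) (Fin 4 → Env k (OSL2 p q)) ⟶
      ModuleCat.of (Env k (OSL2 p q)) (Env k (OSL2 p q)) :=
  ModuleCat.ofHom (Fintype.linearCombination (Env k (OSL2 p q)) g)

theorem linearCombination_single_one {R M : Type*} [Ring R] [AddCommGroup M] [Module R M]
    (v : Fin 4 → M) (i : Fin 4) : Fintype.linearCombination R v (Pi.single i 1) = v i := by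
  simp

theorem exists_homOfVec (f : ModuleCat.of (Env k (OSL2 p q)) (Fin 4 → Env k (OSL2 p q)) ⟶
      ModuleCat.of (Env k (OSL2 p q)) (Env k (OSL2 p q))) : ∃ g, f = homOfVec g := by
  refine ⟨fun i => f.hom (Pi.single i 1), ModuleCat.hom_ext ?_⟩
  refine LinearMap.pi_ext' fun i => LinearMap.ext_ring ?_
  exact (linearCombination_single_one (R := Env k (OSL2 p q)) (M := Env k (OSL2 p q))
    (fun i => f.hom (Pi.single i 1)) i).symm

theorem exists_rightMul (f : ModuleCat.of (Env k (OSL2 p q)) (Env k (OSL2 p q)) ⟶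
      ModuleCat.of (Env k (OSL2 p q)) (Env k (OSL2 p q))) :
    ∃ w, f = rightMul k (OSL2 p q) w := by
  refine ⟨f.hom 1, ModuleCat.hom_ext (LinearMap.ext_ring ?_)⟩
  exact (one_mul _).symm

theorem resD_zero_single (i : Fin 4) : (resD p q 0).hom (Pi.single i 1) = d₁ p q i :=
  linearCombination_single_one (d₁ p q) i

theorem resD_one_single (i : Fin 4) : (resD p q 1).hom (Pi.single i 1) = d₂ p q i :=
  linearCombination_single_one (d₂ p q) i

theorem resD_two_one : (resD p q 2).hom (1 : Env k (OSL2 p q)) = d₃ p q :=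
  one_smul (Env k (OSL2 p q)) _

theorem subsingleton_of_classOf (hp : p ≠ 0) (hq : q ≠ 0) {n : ℕ}
    (h : ∀ f hf, classOf hp hq (n := n) f hf = 0) :
    Subsingleton (HH k (OSL2 p q) n) := by
  refine subsingleton_of_forall_eq 0 fun α => ?_
  obtain ⟨f, hf, rfl⟩ := classOf_surjective hp hq α
  exact h f hf

theorem vanishing_zero (hp : p ≠ 0) (hq : q ≠ 0) : Subsingleton (HH k (OSL2 p q) 0) := by
  refine subsingleton_of_classOf hp hq fun f hf => ?_
  -- There are no coboundaries in degree zero, so the cocycle itself has to vanish.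
  have : f = 0 := by
    obtain ⟨w, rfl⟩ := exists_rightMul f
    have hw : w = 0 := eq_zero_of_d₁_mul hp hq fun i => by
      have := LinearMap.congr_fun (congrArg ModuleCat.Hom.hom hf) (Pi.single i 1)
      exact (congrArg (rightMul k (OSL2 p q) w).hom (resD_zero_single i)).symm.trans this
    subst hw
    refine ModuleCat.hom_ext (LinearMap.ext fun y => ?_)
    exact mul_zero (show Env k (OSL2 p q) from y)
  subst this
  exact (resolution hp hq).extMk_zero _ _

theorem vanishing_one (hp : p ≠ 0) (hq : q ≠ 0) : Subsingleton (HH k (OSL2 p q) 1) := by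
  refine subsingleton_of_classOf hp hq fun f hf => ?_
  rw [classOf_eq_zero_iff]
  obtain ⟨g, rfl⟩ := exists_homOfVec f
  obtain ⟨w, hw⟩ := exists_of_d₂_mul hp hq (f := g) fun r => by
    have := LinearMap.congr_fun (congrArg ModuleCat.Hom.hom hf) (Pi.single r 1)
    exact (congrArg (homOfVec g).hom (resD_one_single r)).symm.trans this
  refine ⟨rightMul k (OSL2 p q) w, ModuleCat.hom_ext ?_⟩
  refine LinearMap.ext fun y => ?_
  have (y : Fin 4 → Env k (OSL2 p q)) : (∑ i, y i * d₁ p q i) * w = ∑ i, y i * g i := by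
    simp only [Finset.sum_mul, mul_assoc, hw]
  exact this y

theorem vanishing_two (hp : p ≠ 0) (hq : q ≠ 0) : Subsingleton (HH k (OSL2 p q) 2) := by
  refine subsingleton_of_classOf hp hq fun f hf => ?_
  rw [classOf_eq_zero_iff]
  obtain ⟨g, rfl⟩ := exists_homOfVec f
  obtain ⟨w, hw⟩ := exists_of_sum_d₃ hp hq (f := g) (by
    have := LinearMap.congr_fun (congrArg ModuleCat.Hom.hom hf) (1 : Env k (OSL2 p q))
    exact (congrArg (homOfVec g).hom resD_two_one).symm.trans this)
  refine ⟨homOfVec w, ModuleCat.hom_ext ?_⟩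
  refine LinearMap.ext fun y => ?_
  have (y : Fin 4 → Env k (OSL2 p q)) :
      ∑ x, (∑ r, y r • d₂ p q r) x * w x = ∑ i, y i * g i := by
    simp only [Finset.sum_apply, Pi.smul_apply, smul_eq_mul, Finset.sum_mul, hw, Finset.mul_sum,
      mul_assoc]
    exact Finset.sum_comm
  exact this y

theorem vanishing_of_four_le (hp : p ≠ 0) (hq : q ≠ 0) (n : ℕ) :
    Subsingleton (HH k (OSL2 p q) (n + 4)) := by
  refine subsingleton_of_classOf hp hq fun f hf => ?_
  have : f = 0 := ModuleCat.hom_ext (LinearMap.ext fun y =>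
    (congrArg f.hom (Subsingleton.elim (α := PUnit) y 0)).trans (map_zero f.hom))
  subst this
  exact (resolution hp hq).extMk_zero _ _

theorem resD_three_comp (f : resX p q 3 ⟶ ModuleCat.of (Env k (OSL2 p q)) (Env k (OSL2 p q))) :
    resD p q 3 ≫ f = 0 := Limits.zero_comp

/-- Every element of the enveloping algebra is a cocycle in degree three. -/
noncomputable def topClass (hp : p ≠ 0) (hq : q ≠ 0) :
    Env k (OSL2 p q) →ₗ[(Env k (OSL2 p q))ᵐᵒᵖ] HH k (OSL2 p q) 3 where
  toFun w := classOf hp hq (n := 3) (rightMul k (OSL2 p q) w) (resD_three_comp _)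
  map_add' w w' := by
    refine Eq.trans ?_ ((resolution hp hq).add_extMk _ _ _ _ _ _).symm
    unfold classOf
    congr 1
    refine ModuleCat.hom_ext (LinearMap.ext fun y => ?_)
    exact mul_add (show Env k (OSL2 p q) from y) w w'
  map_smul' e w := by
    refine Eq.trans ?_ ((resolution hp hq).extMk_comp_mk₀ _ _ _ _ _).symm
    unfold classOf
    congr 1
    refine ModuleCat.hom_ext (LinearMap.ext fun y => ?_)
    exact (mul_assoc (show Env k (OSL2 p q) from y) w e.unop).symm

theorem topClass_surjective (hp : p ≠ 0) (hq : q ≠ 0) :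
    Function.Surjective (topClass (p := p) (q := q) hp hq) := by
  intro α
  obtain ⟨f, hf, rfl⟩ := classOf_surjective hp hq α
  obtain ⟨w, rfl⟩ := exists_rightMul f
  exact ⟨w, rfl⟩

theorem topClass_eq_zero_iff (hp : p ≠ 0) (hq : q ≠ 0) (w : Env k (OSL2 p q)) :
    topClass hp hq w = 0 ↔
    ∃ f : Fin 4 → Env k (OSL2 p q), w = ∑ r, d₃ p q r * f r := by
  refine (classOf_eq_zero_iff hp hq (n := 2) _ (resD_three_comp _)).trans ⟨?_, ?_⟩
  · rintro ⟨g, hg⟩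
    obtain ⟨f, rfl⟩ := exists_homOfVec g
    refine ⟨f, ?_⟩
    have h1 := LinearMap.congr_fun (congrArg ModuleCat.Hom.hom hg) (1 : Env k (OSL2 p q))
    have h2 := (congrArg (homOfVec f).hom (resD_two_one (p := p) (q := q))).symm.trans h1
    exact (h2.trans (one_mul w)).symm
  · rintro ⟨f, rfl⟩
    refine ⟨homOfVec f, ModuleCat.hom_ext (LinearMap.ext_ring ?_)⟩
    refine (congrArg (homOfVec f).hom (resD_two_one (p := p) (q := q))).trans ?_
    exact (one_mul _).symm

/-- Multiplication after the twisted flip. -/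
noncomputable def mulFlip (hp : p ≠ 0) (hq : q ≠ 0) (w : Env k (OSL2 p q)) : OSL2 p q :=
  mulMap k (OSL2 p q) (flip (nakayama p q hp hq) w)

/-- The projection of the enveloping algebra onto the twisted bimodule. -/
noncomputable def toTwist (hp : p ≠ 0) (hq : q ≠ 0) :
    Env k (OSL2 p q) →ₗ[(Env k (OSL2 p q))ᵐᵒᵖ] Twist (nakayama p q hp hq) where
  toFun w := mulFlip hp hq w
  map_add' w w' := by
    unfold mulFlip
    rw [map_add, map_add]
    rfl
  map_smul' e w := by
    obtain ⟨e, rfl⟩ := op_surjective e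
    change mulFlip hp hq (w * e) = (op e : (Env k (OSL2 p q))ᵐᵒᵖ) •
      (show Twist (nakayama p q hp hq) from mulFlip hp hq w)
    unfold mulFlip
    induction e using env_induction with
    | h0 =>
      rw [mul_zero, map_zero, map_zero, op_zero]
      exact (zero_smul (Env k (OSL2 p q))ᵐᵒᵖ
        (show Twist (nakayama p q hp hq) from mulFlip hp hq w)).symm
    | hadd z z' hz hz' =>
      rw [mul_add, map_add, map_add, hz, hz', MulOpposite.op_add]
      exact (add_smul (op z) (op z') (show Twist (nakayama p q hp hq) from mulFlip hp hq w)).symm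
    | hb x y =>
      -- The flip turns right multiplication by `x ⊗ y` into left multiplication by `y ⊗ μ x`, which
      -- acts on products as `m ↦ y m μ(x)`: the action of the twisted bimodule.
      rw [bi_apply, twist_smul, ← bi_apply, flip_mul, flip_bi, ← smul_eq_mul, map_smul, bi_apply,
        regular_smul]

theorem toTwist_surjective (hp : p ≠ 0) (hq : q ≠ 0) :
    Function.Surjective (toTwist (p := p) (q := q) hp hq) := by
  intro x
  have h (x : OSL2 p q) : mulMap k _ (flip (nakayama p q hp hq) (bi 1 x)) = x := by
    rw [flip_bi, mulMap_bi, map_one, mul_one]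
  exact ⟨bi 1 (show OSL2 p q from x), h x⟩

/-- The top cohomology is the twisted bimodule. -/
noncomputable def topEquiv (hp : p ≠ 0) (hq : q ≠ 0) :
    HH k (OSL2 p q) 3 ≃ₗ[(Env k (OSL2 p q))ᵐᵒᵖ] Twist (nakayama p q hp hq) :=
  -- Both modules are quotients of `E` by the right ideal generated by the entries of `d₃`.
  ((topClass hp hq).quotKerEquivOfSurjective (topClass_surjective hp hq)).symm ≪≫ₗ
    (Submodule.quotEquivOfEq _ _ (Submodule.ext fun w =>
      (topClass_eq_zero_iff hp hq w).trans (mulMap_flip_eq_zero_iff hp hq w).symm)) ≪≫ₗ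
    (toTwist hp hq).quotKerEquivOfSurjective (toTwist_surjective hp hq)

end Cohomology

end OSL2

theorem theorem6p13 {k : Type u} [Field k] (p q : k) (hp : p ≠ 0) (hq : q ≠ 0) :
    ∃ μ : OSL2 p q ≃ₐ[k] OSL2 p q,
      μ (OSL2.a p q) = (p * q)⁻¹ • OSL2.a p q ∧
      μ (OSL2.b p q) = OSL2.b p q ∧
      μ (OSL2.c p q) = OSL2.c p q ∧
      μ (OSL2.d p q) = (p * q) • OSL2.d p q ∧
      TwistedCY.IsTwistedCalabiYau k (OSL2 p q) 3 μ := by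
  refine ⟨OSL2.nakayama p q hp hq, OSL2.scale_a _ _ _, OSL2.scale_b _ _ _, OSL2.scale_c _ _ _,
    OSL2.scale_d _ _ _, OSL2.isSmooth hp hq, fun i hi => ?_, ⟨OSL2.topEquiv hp hq⟩⟩
  match i with
  | 0 => exact OSL2.vanishing_zero hp hq
  | 1 => exact OSL2.vanishing_one hp hq
  | 2 => exact OSL2.vanishing_two hp hq
  | 3 => exact absurd rfl hi
  | n + 4 => exact OSL2.vanishing_of_four_le hp hq n
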